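/- Let $d\ge 1$, let $1\le p\le\infty$ with $p>d/2$, let $a>0$ and $0<\lambda\le\Lambda<\infty$, and let $B_1\subset\mathbb R^d$ be the open unit ball; $x_d$ denotes the last coordinate of $x$. Let $F:\mathrm{Sym}(d)\to\mathbb R$ be $(\lambda,\Lambda)$-elliptic, i.e. $$\lambda|N|\le F(M+N)-F(M)\le\Lambda|N|\qquad\text{for all } M,N\in \mathrm{Sym}(d),\ N\ge 0,$$ where $|N|$ is the spectral norm. For $G:\mathrm{Sym}(d)\times B_1\to\mathbb R$, a function $w\in C(B_1)$ is called an $L^p$ viscosity subsolution (resp. supersolution) of $G(D^2w,x)=0$ in $B_1$ if for every (continuous representative of a function) $\varphi\in W^{2,p}_{loc}(B_1)$ and every $x_0\in B_1$ at which $w-\varphi$ has a local maximum (resp. minimum), $$\operatorname*{ess\,lim\,sup}_{x\to x_0} G(D^2\varphi(x),x)\ge 0\qquad\Big(\text{resp. }\operatorname*{ess\,lim\,inf}_{x\to x_0} G(D^2\varphi(x),x)\le 0\Big).$$ Let $\mathcal M^+(M)=\sup\{\operatorname{tr}(AM): A\in \mathrm{Sym}(d),\ \lambda I\le A\le\Lambda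 I\}$ be the maximal Pucci operator with the same constants $\lambda,\Lambda$. **Theorem.** If $u$ is an $L^p$ viscosity subsolution and $v$ is an $L^p$ viscosity supersolution of $|x_d|^aF(D^2w)=0$ in $B_1$, then $u-v\in\underline S$ in $B_1$, that is, $u-v$ is an $L^p$ viscosity subsolution of $|x_d|^a\mathcal M^+(D^2w)=0$ in $B_1$. -/

import Mathlib

open MeasureTheory Filter Topology Set
open scoped ENNReal ContDiff Matrix

noncomputable section

/-- `f` belongs to `L^p_loc(Ω)`: it is `L^p` on every compact subset of `Ω`. -/
def MemLpLoc {d : ℕ} (p : ℝ≥0∞) (Ω : Set (EuclideanSpace ℝ (Fin d)))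
    (f : EuclideanSpace ℝ (Fin d) → ℝ) : Prop :=
  ∀ K : Set (EuclideanSpace ℝ (Fin d)), IsCompact K → K ⊆ Ω → MemLp f p (volume.restrict K)

/-- `g` is the weak (distributional) partial derivative `∂ᵢ f` in the open set `Ω`. -/
def HasWeakPartialDeriv {d : ℕ} (Ω : Set (EuclideanSpace ℝ (Fin d))) (i : Fin d)
    (f g : EuclideanSpace ℝ (Fin d) → ℝ) : Prop :=
  MemLpLoc 1 Ω f ∧ MemLpLoc 1 Ω g ∧
    ∀ η : EuclideanSpace ℝ (Fin d) → ℝ,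
      ContDiff ℝ ∞ η → HasCompactSupport η → tsupport η ⊆ Ω →
        ∫ x, f x * fderiv ℝ η x (EuclideanSpace.single i 1) = - ∫ x, g x * η x

/-- `φ` belongs to `W^{2,p}_loc(Ω)`, with weak Hessian `H` (which is unique, and symmetric,
up to a null subset of `Ω`). -/
def MemW2pLocWithHessian {d : ℕ} (p : ℝ≥0∞) (Ω : Set (EuclideanSpace ℝ (Fin d)))
    (φ : EuclideanSpace ℝ (Fin d) → ℝ)
    (H : EuclideanSpace ℝ (Fin d) → Matrix (Fin d) (Fin d) ℝ) : Prop :=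
  MemLpLoc p Ω φ ∧
    ∃ G : Fin d → EuclideanSpace ℝ (Fin d) → ℝ,
      (∀ i, MemLpLoc p Ω (G i) ∧ HasWeakPartialDeriv Ω i φ (G i)) ∧
      ∀ i j, MemLpLoc p Ω (fun x => H x i j) ∧
        HasWeakPartialDeriv Ω j (G i) (fun x => H x i j)

/-- `ess limsup_{x → x₀} g(x) = lim_{r → 0} ess sup_{B_r(x₀)} g`, as an extended real: sets of
the filter `𝓝 x₀ ⊓ ae volume` are those that contain almost all of a neighbourhood of `x₀`. -/
def essLimsupAt {d : ℕ} (g : EuclideanSpace ℝ (Fin d) → ℝ) (x₀ : EuclideanSpace ℝ (Fin d)) :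
    EReal :=
  limsup (fun x => (g x : EReal)) (𝓝 x₀ ⊓ ae volume)

/-- `ess liminf_{x → x₀} g(x)`, as an extended real. -/
def essLiminfAt {d : ℕ} (g : EuclideanSpace ℝ (Fin d) → ℝ) (x₀ : EuclideanSpace ℝ (Fin d)) :
    EReal :=
  liminf (fun x => (g x : EReal)) (𝓝 x₀ ⊓ ae volume)

/-- `u ∈ C(Ω)` is an `L^p` viscosity subsolution of `F(D²u, x) = f` in the open set `Ω`.
The test functions run over `W^{2,p}_loc(Ω)`, taken in their continuous representatives
(which exist when `p > d/2`). -/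
def IsLpViscositySubsolution {d : ℕ} (p : ℝ≥0∞) (Ω : Set (EuclideanSpace ℝ (Fin d)))
    (F : Matrix (Fin d) (Fin d) ℝ → EuclideanSpace ℝ (Fin d) → ℝ)
    (f : EuclideanSpace ℝ (Fin d) → ℝ) (u : EuclideanSpace ℝ (Fin d) → ℝ) : Prop :=
  ContinuousOn u Ω ∧
    ∀ (φ : EuclideanSpace ℝ (Fin d) → ℝ)
      (H : EuclideanSpace ℝ (Fin d) → Matrix (Fin d) (Fin d) ℝ),
      ContinuousOn φ Ω → MemW2pLocWithHessian p Ω φ H →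
        ∀ x₀ ∈ Ω, IsLocalMax (fun x => u x - φ x) x₀ →
          0 ≤ essLimsupAt (fun x => F (H x) x - f x) x₀

/-- `u ∈ C(Ω)` is an `L^p` viscosity supersolution of `F(D²u, x) = f` in the open set `Ω`. -/
def IsLpViscositySupersolution {d : ℕ} (p : ℝ≥0∞) (Ω : Set (EuclideanSpace ℝ (Fin d)))
    (F : Matrix (Fin d) (Fin d) ℝ → EuclideanSpace ℝ (Fin d) → ℝ)
    (f : EuclideanSpace ℝ (Fin d) → ℝ) (u : EuclideanSpace ℝ (Fin d) → ℝ) : Prop :=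
  ContinuousOn u Ω ∧
    ∀ (φ : EuclideanSpace ℝ (Fin d) → ℝ)
      (H : EuclideanSpace ℝ (Fin d) → Matrix (Fin d) (Fin d) ℝ),
      ContinuousOn φ Ω → MemW2pLocWithHessian p Ω φ H →
        ∀ x₀ ∈ Ω, IsLocalMin (fun x => u x - φ x) x₀ →
          essLiminfAt (fun x => F (H x) x - f x) x₀ ≤ 0

/-- `F` is `(lam, Lam)`-elliptic on symmetric matrices:
`lam |N| ≤ F(M + N) - F(M) ≤ Lam |N|` for `M` symmetric and `N ≥ 0`, where `|N|` is the
spectral (Euclidean operator) norm. Values of `F` off the symmetric matrices play no role. -/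
def IsElliptic {d : ℕ} (lam Lam : ℝ) (F : Matrix (Fin d) (Fin d) ℝ → ℝ) : Prop :=
  ∀ M N : Matrix (Fin d) (Fin d) ℝ, M.IsSymm → N.PosSemidef →
    lam * ‖Matrix.toEuclideanCLM (n := Fin d) (𝕜 := ℝ) N‖ ≤ F (M + N) - F M ∧
    F (M + N) - F M ≤ Lam * ‖Matrix.toEuclideanCLM (n := Fin d) (𝕜 := ℝ) N‖

/-- The maximal Pucci operator
`𝓜⁺(M) = sup { tr(A M) : A symmetric, lam I ≤ A ≤ Lam I }`. -/
def pucciMax {d : ℕ} (lam Lam : ℝ) (M : Matrix (Fin d) (Fin d) ℝ) : ℝ :=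
  sSup {t : ℝ | ∃ A : Matrix (Fin d) (Fin d) ℝ,
    (A - lam • (1 : Matrix (Fin d) (Fin d) ℝ)).PosSemidef ∧
    (Lam • (1 : Matrix (Fin d) (Fin d) ℝ) - A).PosSemidef ∧ t = (A * M).trace}

/-- The weight `|x_d|^a`, where `x_d` is the last coordinate and the dimension is `n + 1`. -/
def lastCoordWeight {n : ℕ} (a : ℝ) (x : EuclideanSpace ℝ (Fin (n + 1))) : ℝ :=
  |x (Fin.last n)| ^ a

/-- The lower Pucci class for the weight `|x_d|^a`: `u` satisfies `|x_d|^a 𝓜⁺(D²u) ≥ f` in `Ω`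
in the `L^p` viscosity sense. -/
def MemPucciLower {n : ℕ} (p : ℝ≥0∞) (Ω : Set (EuclideanSpace ℝ (Fin (n + 1))))
    (a lam Lam : ℝ) (f : EuclideanSpace ℝ (Fin (n + 1)) → ℝ)
    (u : EuclideanSpace ℝ (Fin (n + 1)) → ℝ) : Prop :=
  IsLpViscositySubsolution p Ω (fun M x => lastCoordWeight a x * pucciMax lam Lam M) f u

end

/-! Suppose `u - v - φ` has a local maximum at `x₀` while `|x_d|^a 𝓜⁺(D²φ) ≤ -c < 0` almost
everywhere near `x₀`. The degeneracy on `{x_d = 0}` is overcome by using `φ` itself as a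
perturbation. Let a quadratic `Q` with `F(D²Q) < 0` touch `u` from above at a point `y` near `x₀`.
The contact can be made strict while keeping `F(D²Q) ≤ 0`, so for small `t > 0` a translate of `Q +
tφ` by a constant touches `u` near `y`. There `|x_d|^a F(D²Q + t D²φ) ≤ t |x_d|^a 𝓜⁺(D²φ) ≤ -tc`,
which contradicts the subsolution property. Hence, near `x₀` and across the hyperplane, `u` is an
ordinary viscosity subsolution of `F(D²u) ≥ 0`
(`IsLpViscositySubsolution.isQuadraticSubsolutionAt`). The same holds for `-v` with the dual
operator `M ↦ -F(-M)`.

What remains is a nondegenerate comparison (`no_touching_of_isQuadraticSubsolutionAt`). Since `|x_d|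
≤ 1`, also `𝓜⁺(D²φ) ≤ -c` a.e. This is a family of linear inequalities `tr(A D²φ) ≤ -c`, so it
survives mollification of `φ` to a smooth `ψ` (`MemW2pLocWithHessian.exists_contDiff_approx`). The
functions `u` and `-v` are replaced by `C^{1,1}` functions `U` and `W`, a sup-convolution followed
by an inf-convolution, which satisfy their equations wherever the gradient is differentiable, hence
a.e. by Rademacher. By an argument of Jensen type (`exists_isLocalMax_sub_inner`), some tilt of `U +
W - ψ - η|x - x₀|²/2` has a local maximum at such a point. There `D²U ≤ -D²W + D²ψ + ηI`, and
`IsElliptic.exists_admissible` gives `0 ≤ F(D²U) ≤ F(-D²W) + tr(A(D²ψ + ηI)) ≤ -c + ηdΛ < 0` for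
small `η`. -/

/-! ### Elliptic functions of matrices and the Pucci operator. -/

/-- `A` is admissible in the definition of the Pucci operator: `lam I ≤ A ≤ Lam I`. -/
def PucciAdmissible {d : ℕ} (lam Lam : ℝ) (A : Matrix (Fin d) (Fin d) ℝ) : Prop :=
  (A - lam • (1 : Matrix (Fin d) (Fin d) ℝ)).PosSemidef ∧
    (Lam • (1 : Matrix (Fin d) (Fin d) ℝ) - A).PosSemidef

namespace PucciAdmissible

variable {d : ℕ} {lam Lam : ℝ} {A : Matrix (Fin d) (Fin d) ℝ}

theorem diag_le (hA : PucciAdmissible lam Lam A) (i : Fin d) : A i i ≤ Lam := by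
  have := hA.2.diag_nonneg (i := i)
  simpa using this

theorem posSemidef (hlam : 0 ≤ lam) (hA : PucciAdmissible lam Lam A) : A.PosSemidef := by
  have h : (lam • (1 : Matrix (Fin d) (Fin d) ℝ)).PosSemidef := Matrix.PosSemidef.one.smul hlam
  simpa using hA.1.add h

/-- Testing `A ≥ 0` on `eᵢ ± eⱼ` gives `2|Aᵢⱼ| ≤ Aᵢᵢ + Aⱼⱼ`, and diagonal entries are at most `Lam`.
-/
theorem abs_apply_le (hlam : 0 ≤ lam) (hA : PucciAdmissible lam Lam A) (i j : Fin d) :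
    |A i j| ≤ Lam := by
  have hP := hA.posSemidef hlam
  have hs : A j i = A i j := by simpa using hP.1.apply i j
  have key : ∀ t : ℝ, 0 ≤ A i i + t * A i j + t * A j i + t * t * A j j := by
    intro t
    have := hP.dotProduct_mulVec_nonneg (Pi.single i 1 + t • Pi.single j 1)
    simp only [star_trivial, Matrix.mulVec_add, Matrix.mulVec_smul, add_dotProduct,
      dotProduct_add, smul_dotProduct, dotProduct_smul, Matrix.mulVec_single_one,
      single_one_dotProduct, Matrix.col_apply, smul_eq_mul] at this
    linarith
  have h1 := key 1
  have h2 := key (-1)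
  have h3 := hA.diag_le i
  have h4 := hA.diag_le j
  rw [abs_le]
  constructor <;> linarith

theorem trace_mul_le (hlam : 0 ≤ lam) (hA : PucciAdmissible lam Lam A)
    (M : Matrix (Fin d) (Fin d) ℝ) : (A * M).trace ≤ ∑ i, ∑ j, Lam * |M j i| := by
  simp only [Matrix.trace, Matrix.diag_apply, Matrix.mul_apply]
  refine Finset.sum_le_sum fun i _ => Finset.sum_le_sum fun j _ => ?_
  calc A i j * M j i ≤ |A i j * M j i| := le_abs_self _
    _ = |A i j| * |M j i| := abs_mul _ _
    _ ≤ Lam * |M j i| := by gcongr; exact hA.abs_apply_le hlam i j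

theorem trace_le (hA : PucciAdmissible lam Lam A) : A.trace ≤ d * Lam := by
  calc A.trace = ∑ i, A i i := rfl
    _ ≤ ∑ _i : Fin d, Lam := Finset.sum_le_sum fun i _ => hA.diag_le i
    _ = d * Lam := by simp

/-- Every admissible matrix gives a lower bound for the Pucci operator. -/
theorem trace_mul_le_pucciMax (hlam : 0 ≤ lam) (hA : PucciAdmissible lam Lam A)
    (M : Matrix (Fin d) (Fin d) ℝ) : (A * M).trace ≤ pucciMax lam Lam M := by
  -- Boundedness matters here: the real `sSup` of an unbounded set is `0`.
  refine le_csSup ⟨∑ i, ∑ j, Lam * |M j i|, ?_⟩ ⟨A, hA.1, hA.2, rfl⟩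
  rintro t ⟨B, hB1, hB2, rfl⟩
  exact trace_mul_le hlam ⟨hB1, hB2⟩ M

end PucciAdmissible

theorem norm_toEuclideanCLM_vecMulVec_self {d : ℕ} (v : EuclideanSpace ℝ (Fin d))
    (hv : ‖v‖ = 1) :
    ‖Matrix.toEuclideanCLM (n := Fin d) (𝕜 := ℝ) (Matrix.vecMulVec v v)‖ = 1 := by
  have happ : ∀ x, Matrix.toEuclideanCLM (n := Fin d) (𝕜 := ℝ) (Matrix.vecMulVec v v) x
      = (inner ℝ v x) • v := by
    intro x
    ext i
    simp only [Matrix.ofLp_toEuclideanCLM, Matrix.vecMulVec_mulVec, PiLp.smul_apply]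
    simp [PiLp.inner_apply, dotProduct, mul_comm]
  refine le_antisymm (ContinuousLinearMap.opNorm_le_bound _ zero_le_one fun x => ?_) ?_
  · rw [happ, norm_smul, hv, mul_one, one_mul]
    simpa [hv] using norm_inner_le_norm (𝕜 := ℝ) v x
  · have h := ContinuousLinearMap.le_opNorm
      (Matrix.toEuclideanCLM (n := Fin d) (𝕜 := ℝ) (Matrix.vecMulVec v v)) v
    rw [happ, real_inner_self_eq_norm_sq, hv] at h
    simpa [hv] using h

theorem posSemidef_vecMulVec_self {d : ℕ} (v : Fin d → ℝ) :
    (Matrix.vecMulVec v v).PosSemidef := by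
  simpa using Matrix.posSemidef_vecMulVec_self_star v

/-- Adding a multiple of a rank one projection. -/
theorem IsElliptic.add_smul_vecMulVec_le {d : ℕ} {lam Lam : ℝ}
    {F : Matrix (Fin d) (Fin d) ℝ → ℝ} (hF : IsElliptic lam Lam F)
    {M : Matrix (Fin d) (Fin d) ℝ} (hM : M.IsSymm) (v : EuclideanSpace ℝ (Fin d))
    (hv : ‖v‖ = 1) (t : ℝ) :
    F (M + t • Matrix.vecMulVec v v) - F M ≤ (if 0 ≤ t then Lam else lam) * t := by
  have hP := posSemidef_vecMulVec_self (v : Fin d → ℝ)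
  split_ifs with ht
  · have := (hF M (t • Matrix.vecMulVec v v) hM (hP.smul ht)).2
    rw [map_smul, norm_smul, norm_toEuclideanCLM_vecMulVec_self v hv, mul_one,
      Real.norm_of_nonneg ht] at this
    exact this
  -- For `t < 0`, `M` is recovered from `M + t vvᵀ` by adding the nonnegative `-t vvᵀ`, so the lower
  -- ellipticity bound applies.
  · push Not at ht
    have hs : (M + t • Matrix.vecMulVec v v).IsSymm :=
      hM.add (Matrix.IsSymm.smul (by simp [Matrix.IsSymm]) t)
    have := (hF _ ((-t) • Matrix.vecMulVec v v) hs (hP.smul (by linarith))).1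
    rw [map_smul, norm_smul, norm_toEuclideanCLM_vecMulVec_self v hv, mul_one,
      Real.norm_of_nonneg (by linarith)] at this
    have e : M + t • Matrix.vecMulVec (v : Fin d → ℝ) v + (-t) • Matrix.vecMulVec v v = M := by
      module
    rw [e] at this
    linarith

/-- An elliptic function grows at most like the Pucci operator with the same constants. -/
theorem IsElliptic.exists_admissible {d : ℕ} {lam Lam : ℝ} (hLam : lam ≤ Lam)
    {F : Matrix (Fin d) (Fin d) ℝ → ℝ} (hF : IsElliptic lam Lam F)
    {M N : Matrix (Fin d) (Fin d) ℝ} (hM : M.IsSymm) (hN : N.IsSymm) :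
    ∃ A, PucciAdmissible lam Lam A ∧ F (M + N) - F M ≤ (A * N).trace := by
  have hH : N.IsHermitian := by simpa [Matrix.IsSymm, Matrix.IsHermitian] using hN
  set v := hH.eigenvectorBasis
  set e := hH.eigenvalues
  set V : Fin d → Matrix (Fin d) (Fin d) ℝ := fun i => Matrix.vecMulVec (v i) (v i) with hV
  have hv1 : ∀ i, ‖v i‖ = 1 := v.orthonormal.1
  have hVP : ∀ i, (V i).PosSemidef := fun i => posSemidef_vecMulVec_self _
  have hVs : ∀ i, (V i).IsSymm := fun i => by
    simpa [Matrix.IsSymm, Matrix.IsHermitian] using (hVP i).1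
  have hone : ∑ i, V i = 1 := by
    have h := Matrix.mem_unitaryGroup_iff.1 (hH.eigenvectorUnitary).2
    rw [← h]
    ext a b
    simp [Matrix.sum_apply, V, Matrix.vecMulVec_apply, Matrix.mul_apply, v, Matrix.star_apply]
  have hNV : N = ∑ i, e i • V i := by
    rw [← mul_one N, ← hone, Finset.mul_sum]
    refine Finset.sum_congr rfl fun i _ => ?_
    rw [hV]
    simp only [Matrix.mul_vecMulVec]
    rw [hH.mulVec_eigenvectorBasis, Matrix.smul_vecMulVec]
  have htr : ∀ i, (V i * N).trace = e i := by
    intro i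
    rw [Matrix.trace_mul_comm]
    simp only [V, Matrix.mul_vecMulVec]
    rw [hH.mulVec_eigenvectorBasis, Matrix.smul_vecMulVec, Matrix.trace_smul,
      Matrix.trace_vecMulVec]
    have : (v i : Fin d → ℝ) ⬝ᵥ (v i) = ‖v i‖ ^ 2 := by
      rw [EuclideanSpace.real_norm_sq_eq]
      simp [dotProduct, sq]
    change e i • ((v i : Fin d → ℝ) ⬝ᵥ (v i)) = e i
    rw [this, hv1]
    simp
  -- The optimal admissible matrix is diagonal in an eigenbasis of `N`, with `Lam` on nonnegative
  -- eigenvalues and `lam` on negative ones. The bound then follows by adding the spectral pieces of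
  -- `N` one at a time.
  set c : Fin d → ℝ := fun i => if 0 ≤ e i then Lam else lam with hc
  have hc1 : ∀ i, lam ≤ c i := fun i => by simp only [hc]; split_ifs <;> linarith
  have hc2 : ∀ i, c i ≤ Lam := fun i => by simp only [hc]; split_ifs <;> linarith
  have hstep : ∀ s : Finset (Fin d),
      (M + ∑ i ∈ s, e i • V i).IsSymm ∧
      F (M + ∑ i ∈ s, e i • V i) - F M ≤ ∑ i ∈ s, c i * e i := by
    intro s
    induction s using Finset.induction_on with
    | empty => simpa using hM
    | insert i s hi ih =>
      rw [Finset.sum_insert hi, Finset.sum_insert hi]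
      have e1 : M + (e i • V i + ∑ j ∈ s, e j • V j) = (M + ∑ j ∈ s, e j • V j) + e i • V i := by
        abel
      rw [e1]
      refine ⟨ih.1.add ((hVs i).smul _), ?_⟩
      have := hF.add_smul_vecMulVec_le ih.1 (v i) (hv1 i) (e i)
      have h2 := ih.2
      simp only [hc] at h2 ⊢
      simp only [V] at this h2 ⊢
      linarith
  refine ⟨∑ i, c i • V i, ⟨?_, ?_⟩, ?_⟩
  · rw [← hone, Finset.smul_sum, ← Finset.sum_sub_distrib]
    refine Matrix.posSemidef_sum _ fun i _ => ?_
    rw [← sub_smul]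
    exact (hVP i).smul (by linarith [hc1 i])
  · rw [← hone, Finset.smul_sum, ← Finset.sum_sub_distrib]
    refine Matrix.posSemidef_sum _ fun i _ => ?_
    rw [← sub_smul]
    exact (hVP i).smul (by linarith [hc2 i])
  · have h := (hstep Finset.univ).2
    rw [← hNV] at h
    refine h.trans (le_of_eq ?_)
    rw [Finset.sum_mul, Matrix.trace_sum]
    refine Finset.sum_congr rfl fun i _ => ?_
    rw [Matrix.smul_mul, Matrix.trace_smul, htr, smul_eq_mul]

/-- The dual operator `M ↦ -F (-M)` has the same ellipticity constants. -/
theorem IsElliptic.neg_comp_neg {d : ℕ} {lam Lam : ℝ}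
    {F : Matrix (Fin d) (Fin d) ℝ → ℝ} (hF : IsElliptic lam Lam F) :
    IsElliptic lam Lam (fun M => -F (-M)) := by
  intro M N hM hN
  have hNs : N.IsSymm := by simpa [Matrix.IsSymm, Matrix.IsHermitian] using hN.1
  have h := hF (-(M + N)) N ((hM.add hNs).neg) hN
  have e : -(M + N) + N = -M := by abel
  rw [e] at h
  constructor <;> linarith [h.1, h.2]

theorem IsElliptic.mono {d : ℕ} {lam Lam : ℝ} (hlam : 0 ≤ lam)
    {F : Matrix (Fin d) (Fin d) ℝ → ℝ} (hF : IsElliptic lam Lam F)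
    {M N : Matrix (Fin d) (Fin d) ℝ} (hM : M.IsSymm) (hMN : (N - M).PosSemidef) : F M ≤ F N := by
  have h := (hF M (N - M) hM hMN).1
  rw [add_sub_cancel] at h
  have : 0 ≤ lam * ‖Matrix.toEuclideanCLM (n := Fin d) (𝕜 := ℝ) (N - M)‖ := by positivity
  linarith

/-! ### Sup-convolutions and `C^{1,1}` regularisation. -/

section Regularization

variable {E : Type*} [NormedAddCommGroup E]

/-- The sup-convolution `z ↦ max_{y ∈ D} (u y - |z - y|² / (2 s))`. -/
noncomputable def supConv (s : ℝ) (D : Set E) (u : E → ℝ) (z : E) : ℝ :=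
  sSup ((fun y => u y - ‖z - y‖ ^ 2 / (2 * s)) '' D)

variable {s : ℝ} {D : Set E} {u : E → ℝ}

theorem continuousOn_sub_sq_norm (hu : ContinuousOn u D) (s : ℝ) (z : E) :
    ContinuousOn (fun y => u y - ‖z - y‖ ^ 2 / (2 * s)) D := by
  fun_prop

theorem le_supConv (hD : IsCompact D) (hu : ContinuousOn u D) (z : E) {y : E} (hy : y ∈ D) :
    u y - ‖z - y‖ ^ 2 / (2 * s) ≤ supConv s D u z :=
  le_csSup (hD.image_of_continuousOn (continuousOn_sub_sq_norm hu s z)).bddAbove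
    (mem_image_of_mem _ hy)

theorem exists_supConv_eq (hD : IsCompact D) (hne : D.Nonempty) (hu : ContinuousOn u D)
    (z : E) : ∃ y ∈ D, supConv s D u z = u y - ‖z - y‖ ^ 2 / (2 * s) := by
  obtain ⟨y, hy, h⟩ := hD.exists_sSup_image_eq hne (continuousOn_sub_sq_norm hu s z)
  exact ⟨y, hy, h⟩

theorem continuous_supConv (hD : IsCompact D) (hu : ContinuousOn u D) :
    Continuous (supConv s D u) := by
  have : CompactSpace D := isCompact_iff_compactSpace.1 hD
  have hu' : Continuous (D.domRestrict u) := hu.domRestrict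
  have h := (isCompact_univ (X := D)).continuous_sSup
    (f := fun (z : E) (y : D) => D.domRestrict u y - ‖z - y‖ ^ 2 / (2 * s)) (by fun_prop)
  convert h using 2 with z
  simp only [supConv]
  congr 1
  ext t
  simp [Set.domRestrict_apply]

variable [InnerProductSpace ℝ E]

theorem norm_sub_lineMap_sq (x z w : E) (t : ℝ) :
    ‖x - (z + t • (w - z))‖ ^ 2 =
      (1 - t) * ‖x - z‖ ^ 2 + t * ‖x - w‖ ^ 2 - t * (1 - t) * ‖w - z‖ ^ 2 := by
  have e1 : x - (z + t • (w - z)) = (x - z) - t • (w - z) := by abel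
  have e2 : x - w = (x - z) - (w - z) := by abel
  rw [e1, e2, norm_sub_sq_real (x - z) (t • (w - z)), norm_sub_sq_real (x - z) (w - z), norm_smul, inner_smul_right, mul_pow,
    Real.norm_eq_abs, sq_abs]
  ring

/-- Each competitor has Hessian `-1/s`, so the supremum plus `|z|²/(2s)` is convex; this is that
semiconvexity along a segment. -/
theorem supConv_lineMap_le (hD : IsCompact D) (hne : D.Nonempty) (hu : ContinuousOn u D)
    (z w : E) {t : ℝ} (ht0 : 0 ≤ t) (ht1 : t ≤ 1) :
    supConv s D u (z + t • (w - z)) ≤ (1 - t) * supConv s D u z + t * supConv s D u w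
      + t * (1 - t) * ‖w - z‖ ^ 2 / (2 * s) := by
  obtain ⟨y, hy, h⟩ := exists_supConv_eq (s := s) hD hne hu (z + t • (w - z))
  have h1 := mul_le_mul_of_nonneg_left (le_supConv (s := s) hD hu z hy) (sub_nonneg.2 ht1)
  have h2 := mul_le_mul_of_nonneg_left (le_supConv (s := s) hD hu w hy) ht0
  rw [h, norm_sub_rev _ y, norm_sub_lineMap_sq, norm_sub_rev y z, norm_sub_rev y w]
  have : u y - ((1 - t) * ‖z - y‖ ^ 2 + t * ‖w - y‖ ^ 2 - t * (1 - t) * ‖w - z‖ ^ 2) / (2 * s)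
      = (1 - t) * (u y - ‖z - y‖ ^ 2 / (2 * s)) + t * (u y - ‖w - y‖ ^ 2 / (2 * s))
        + t * (1 - t) * ‖w - z‖ ^ 2 / (2 * s) := by ring
  linarith

/-- This replaces the limit `t → 0`: if `b < a`, then `a > 0` and `t = (a - b)/(2a)` would give `(a
+ b)/2 ≤ b`. -/
theorem le_of_forall_one_sub_mul_le {a b : ℝ}
    (h : ∀ t : ℝ, 0 < t → t < 1 → (1 - t) * a ≤ b) : a ≤ b := by
  by_contra hab
  push Not at hab
  have hb : 0 ≤ b := by
    have := h (1 / 2) (by norm_num) (by norm_num)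
    linarith
  have ha' : 0 < a := lt_of_le_of_lt hb hab
  have := h ((a - b) / (2 * a)) (by apply div_pos <;> linarith)
    (by rw [div_lt_one (by linarith)]; linarith)
  have e : (1 - (a - b) / (2 * a)) * a = (a + b) / 2 := by
    field_simp
    ring
  linarith

/-- A minimiser of `z ↦ f z + |x - z|² / (2 δ)`, where `f` is a sup-convolution of larger
parameter, is a strong minimiser. -/
theorem supConv_add_sq_norm_strong_min (hD : IsCompact D) (hne : D.Nonempty)
    (hu : ContinuousOn u D) {δ : ℝ} (hδ : 0 < δ) (hs : δ < s) {x z : E}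
    (hz : ∀ w, supConv s D u z + ‖x - z‖ ^ 2 / (2 * δ) ≤
      supConv s D u w + ‖x - w‖ ^ 2 / (2 * δ)) (w : E) :
    supConv s D u z + ‖x - z‖ ^ 2 / (2 * δ) + (1 / δ - 1 / s) / 2 * ‖w - z‖ ^ 2 ≤
      supConv s D u w + ‖x - w‖ ^ 2 / (2 * δ) := by
  have hc : 0 < 1 / δ - 1 / s := sub_pos.2 (one_div_lt_one_div_of_lt hδ hs)
  suffices H : (1 / δ - 1 / s) / 2 * ‖w - z‖ ^ 2 ≤
      supConv s D u w + ‖x - w‖ ^ 2 / (2 * δ) - (supConv s D u z + ‖x - z‖ ^ 2 / (2 * δ)) by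
    linarith
  refine le_of_forall_one_sub_mul_le fun t ht0 ht1 => ?_
  have h1 := supConv_lineMap_le (s := s) hD hne hu z w ht0.le ht1.le
  have h2 := hz (z + t • (w - z))
  rw [norm_sub_lineMap_sq x z w t] at h2
  have h3 : t * ((1 - t) * ((1 / δ - 1 / s) / 2 * ‖w - z‖ ^ 2)) ≤
      t * (supConv s D u w + ‖x - w‖ ^ 2 / (2 * δ)
        - (supConv s D u z + ‖x - z‖ ^ 2 / (2 * δ))) := by
    have e : t * ((1 - t) * ((1 / δ - 1 / s) / 2 * ‖w - z‖ ^ 2)) =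
      t * (1 - t) * ‖w - z‖ ^ 2 / (2 * δ) - t * (1 - t) * ‖w - z‖ ^ 2 / (2 * s) := by
      ring
    have e2 : ((1 - t) * ‖x - z‖ ^ 2 + t * ‖x - w‖ ^ 2 - t * (1 - t) * ‖w - z‖ ^ 2) / (2 * δ)
      = (1 - t) * (‖x - z‖ ^ 2 / (2 * δ)) + t * (‖x - w‖ ^ 2 / (2 * δ))
        - t * (1 - t) * ‖w - z‖ ^ 2 / (2 * δ) := by ring
    rw [e2] at h2
    rw [e]
    linarith
  exact le_of_mul_le_mul_left h3 ht0

/-- Coercivity: a sup-convolution decreases at most like `-|w|²/(2s)`, which the penalty `|w|²/(2δ)`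
dominates because `δ < s`. -/
theorem exists_supConv_add_sq_norm_min [ProperSpace E] (hD : IsCompact D) (hne : D.Nonempty)
    (hu : ContinuousOn u D) {δ : ℝ} (hδ : 0 < δ) (hs : δ < s) (x : E) :
    ∃ z, ∀ w, supConv s D u z + ‖x - z‖ ^ 2 / (2 * δ) ≤
      supConv s D u w + ‖x - w‖ ^ 2 / (2 * δ) := by
  obtain ⟨y, hy⟩ := hne
  have hs0 : 0 < s := hδ.trans hs
  have hc : 0 < 1 / δ - 1 / s := sub_pos.2 (one_div_lt_one_div_of_lt hδ hs)
  have hcont : Continuous fun w => supConv s D u w + ‖x - w‖ ^ 2 / (2 * δ) := by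
    have := continuous_supConv (s := s) hD hu
    fun_prop
  have hlow : ∀ w, (u y - ‖x - y‖ ^ 2 / s) + ((1 / δ - 1 / s) / 2 * ‖w - x‖ ^ 2
      - ‖x - y‖ / s * ‖w - x‖) ≤ supConv s D u w + ‖x - w‖ ^ 2 / (2 * δ) := by
    intro w
    have h := le_supConv (s := s) hD hu w hy
    have h2 : ‖w - y‖ ^ 2 ≤ (‖w - x‖ + ‖x - y‖) ^ 2 := by
      gcongr
      exact norm_sub_le_norm_sub_add_norm_sub _ _ _
    have h3 : ‖w - y‖ ^ 2 / (2 * s) ≤ (‖w - x‖ + ‖x - y‖) ^ 2 / (2 * s) := by gcongr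
    have h4 : 0 ≤ ‖x - y‖ ^ 2 / (2 * s) := by positivity
    rw [norm_sub_rev x w]
    have e : (u y - ‖x - y‖ ^ 2 / s) + ((1 / δ - 1 / s) / 2 * ‖w - x‖ ^ 2
      - ‖x - y‖ / s * ‖w - x‖) = u y - (‖w - x‖ + ‖x - y‖) ^ 2 / (2 * s)
        + ‖w - x‖ ^ 2 / (2 * δ) - ‖x - y‖ ^ 2 / (2 * s) := by
      field_simp
      ring
    linarith
  refine hcont.exists_forall_le (tendsto_atTop_mono hlow ?_)
  have hn : Tendsto (fun w : E => ‖w - x‖) (cocompact E) atTop := by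
    have := tendsto_dist_right_cocompact_atTop x
    simpa [dist_eq_norm] using this
  have hq : Tendsto (fun r : ℝ => (u y - ‖x - y‖ ^ 2 / s) + r * ((1 / δ - 1 / s) / 2 * r
      - ‖x - y‖ / s)) atTop atTop := by
    refine tendsto_atTop_add_const_left _ _ (tendsto_id.atTop_mul_atTop₀ ?_)
    exact tendsto_atTop_add_const_right _ _ (tendsto_id.const_mul_atTop (by positivity))
  refine (hq.comp hn).congr fun w => ?_
  simp only [Function.comp]
  ring

/-- A double regularisation `U` of `u` on the compact set `D`, by a sup-convolution followed by an
inf-convolution. It is of class `C^{1,1}`, its gradient at `x` is `(x - P x) / δ`, and near the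
points of differentiability of `P` either it touches a sup-convolution of `u`
or `P` is constant on a segment. -/
theorem exists_sup_inf_convolution [ProperSpace E] (hD : IsCompact D) (hne : D.Nonempty)
    (hu : ContinuousOn u D) {ε δ : ℝ} (hε : 0 < ε) (hδ : 0 < δ) :
    ∃ (U : E → ℝ) (P : E → E),
      LipschitzWith (Real.toNNReal ((ε + δ) / ε)) P ∧
      (∀ x, HasFDerivAt U (innerSL ℝ ((1 / δ) • (x - P x))) x) ∧
      (∀ x, ∀ y ∈ D, u y - ‖x - y‖ ^ 2 / (2 * ε) ≤ U x) ∧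
      (∀ x, ∃ y ∈ D, U x ≤ u y - ‖x - y‖ ^ 2 / (2 * (ε + δ))) ∧
      (∀ x, ∃ y ∈ D, ∃ x', U x' = u y - ‖x' - y‖ ^ 2 / (2 * ε) ∧
        ∀ t : ℝ, 0 ≤ t → t ≤ 1 → P (x + t • (x' - x)) = P x) := by
  set s := ε + δ with hs
  have hδs : δ < s := by linarith
  have hs0 : 0 < s := by linarith
  have hc : 0 < 1 / δ - 1 / s := sub_pos.2 (one_div_lt_one_div_of_lt hδ hδs)
  set f := supConv s D u with hf
  choose P hP using exists_supConv_add_sq_norm_min (s := s) hD hne hu hδ hδs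
  set U : E → ℝ := fun x => f (P x) + ‖x - P x‖ ^ 2 / (2 * δ) with hU
  have hPs : ∀ x w, f (P x) + ‖x - P x‖ ^ 2 / (2 * δ) + (1 / δ - 1 / s) / 2 * ‖w - P x‖ ^ 2 ≤
      f w + ‖x - w‖ ^ 2 / (2 * δ) := fun x w =>
    supConv_add_sq_norm_strong_min hD hne hu hδ hδs (hP x) w
  have hPu : ∀ x z, (∀ w, f z + ‖x - z‖ ^ 2 / (2 * δ) ≤ f w + ‖x - w‖ ^ 2 / (2 * δ)) →
      P x = z := by
    intro x z hz
    have h1 := hPs x z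
    have h2 := hz (P x)
    have h3 : (1 / δ - 1 / s) / 2 * ‖z - P x‖ ^ 2 ≤ 0 := by linarith
    have h4 : ‖z - P x‖ ^ 2 ≤ 0 := by
      by_contra h
      push Not at h
      have : 0 < (1 / δ - 1 / s) / 2 * ‖z - P x‖ ^ 2 := by positivity
      linarith
    have h5 : ‖z - P x‖ = 0 := by
      have := sq_nonneg ‖z - P x‖
      exact pow_eq_zero_iff (two_ne_zero) |>.1 (le_antisymm h4 this)
    exact (sub_eq_zero.1 (norm_eq_zero.1 h5)).symm
  have hinner : ∀ x x' z z' : E, ‖x - z'‖ ^ 2 - ‖x - z‖ ^ 2 + (‖x' - z‖ ^ 2 - ‖x' - z'‖ ^ 2)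
      = 2 * inner ℝ (x - x') (z - z') := by
    intro x x' z z'
    simp only [norm_sub_sq_real, inner_sub_left, inner_sub_right]
    ring
  -- Adding the strong minimality inequalities at `x` and `x'`, each tested with the other
  -- minimiser, makes the values of `f` cancel.
  have hlip : ∀ x x', ‖P x - P x'‖ ≤ s / ε * ‖x - x'‖ := by
    intro x x'
    have h1 := hPs x (P x')
    have h2 := hPs x' (P x)
    rw [norm_sub_rev (P x') (P x)] at h1
    have h3 := hinner x x' (P x) (P x')
    have h4 := real_inner_le_norm (x - x') (P x - P x')
    have h5 : (1 / δ - 1 / s) * ‖P x - P x'‖ ^ 2 ≤ 1 / δ * (‖x - x'‖ * ‖P x - P x'‖) := by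
      calc (1 / δ - 1 / s) * ‖P x - P x'‖ ^ 2 ≤ (‖x - P x'‖ ^ 2 - ‖x - P x‖ ^ 2
            + (‖x' - P x‖ ^ 2 - ‖x' - P x'‖ ^ 2)) / (2 * δ) := by
            simp only [sub_div, add_div]
            linarith
        _ = 1 / δ * inner ℝ (x - x') (P x - P x') := by rw [h3]; field_simp
        _ ≤ _ := by gcongr
    rcases (norm_nonneg (P x - P x')).eq_or_lt with h0 | h0
    · rw [← h0]; positivity
    · have h6 : (1 / δ - 1 / s) * ‖P x - P x'‖ ≤ 1 / δ * ‖x - x'‖ := by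
        refine le_of_mul_le_mul_right ?_ h0
        calc _ = (1 / δ - 1 / s) * ‖P x - P x'‖ ^ 2 := by ring
          _ ≤ _ := h5
          _ = _ := by ring
      have e : 1 / δ - 1 / s = ε / (δ * s) := by
        rw [hs]; field_simp; ring
      rw [e] at h6
      calc ‖P x - P x'‖ = δ * s / ε * (ε / (δ * s) * ‖P x - P x'‖) := by field_simp
        _ ≤ δ * s / ε * (1 / δ * ‖x - x'‖) := by gcongr
        _ = s / ε * ‖x - x'‖ := by field_simp
  -- `P x` is a competitor at `x'`, so `U` lies below a paraboloid of opening `1/δ` that touches it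
  -- at `x`.
  have hUupper : ∀ x x', U x' ≤ U x + 1 / δ * inner ℝ (x - P x) (x' - x)
      + ‖x' - x‖ ^ 2 / (2 * δ) := by
    intro x x'
    have h := hP x' (P x)
    have e : ‖x' - P x‖ ^ 2 = ‖x - P x‖ ^ 2 + 2 * inner ℝ (x - P x) (x' - x) + ‖x' - x‖ ^ 2 := by
      rw [← norm_add_sq_real]
      congr 2
      abel
    rw [e] at h
    calc U x' ≤ _ := h
      _ = _ := by simp only [hU]; field_simp; ring
  refine ⟨U, P, ?_, ?_, ?_, ?_, ?_⟩
  · refine LipschitzWith.of_dist_le_mul fun x x' => ?_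
    rw [dist_eq_norm, dist_eq_norm, Real.coe_toNNReal _ (by positivity)]
    exact hlip x x'
  · intro x
    set C : ℝ := 1 / δ * (1 + s / ε) + 1 / (2 * δ) with hC
    -- The lower bound is the paraboloid inequality with `x` and `x'` exchanged; the Lipschitz bound
    -- on `P` controls the change of gradient.
    have hbound : ∀ x', ‖U x' - U x - innerSL ℝ ((1 / δ) • (x - P x)) (x' - x)‖
        ≤ C * ‖x' - x‖ ^ 2 := by
      intro x'
      have h1 := hUupper x x'
      have h2 := hUupper x' x
      have h3 : |inner ℝ ((x' - P x') - (x - P x)) (x' - x)| ≤ (1 + s / ε) * ‖x' - x‖ ^ 2 := by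
        refine (abs_real_inner_le_norm _ _).trans ?_
        have : ‖(x' - P x') - (x - P x)‖ ≤ (1 + s / ε) * ‖x' - x‖ := by
          calc ‖(x' - P x') - (x - P x)‖ = ‖(x' - x) - (P x' - P x)‖ := by congr 1; abel
            _ ≤ ‖x' - x‖ + ‖P x' - P x‖ := norm_sub_le _ _
            _ ≤ ‖x' - x‖ + s / ε * ‖x' - x‖ := by gcongr; exact hlip _ _
            _ = _ := by ring
        calc _ ≤ ((1 + s / ε) * ‖x' - x‖) * ‖x' - x‖ := by gcongr
          _ = _ := by ring
      have h4 : inner ℝ ((x' - P x') - (x - P x)) (x' - x)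
          = - inner ℝ (x' - P x') (x - x') - inner ℝ (x - P x) (x' - x) := by
        rw [inner_sub_left, ← inner_neg_right, neg_sub]
      rw [h4, abs_le] at h3
      have h5 := mul_le_mul_of_nonneg_left h3.1 (one_div_pos.2 hδ).le
      rw [norm_sub_rev x x'] at h2
      have hn : 0 ≤ 1 / δ * ((1 + s / ε) * ‖x' - x‖ ^ 2) := by positivity
      have e1 : C * ‖x' - x‖ ^ 2 = 1 / δ * ((1 + s / ε) * ‖x' - x‖ ^ 2)
        + ‖x' - x‖ ^ 2 / (2 * δ) := by rw [hC]; ring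
      rw [Real.norm_eq_abs, abs_le, innerSL_apply_apply, inner_smul_left, e1]
      simp only [conj_trivial]
      constructor <;> linarith
    refine HasFDerivAt.of_isLittleO ?_
    have hO : (fun x' => U x' - U x - innerSL ℝ ((1 / δ) • (x - P x)) (x' - x)) =O[𝓝 x]
        fun x' => ‖x' - x‖ ^ 2 :=
      Asymptotics.IsBigO.of_bound C (Eventually.of_forall fun x' => by
        rw [norm_pow, norm_norm]; exact hbound x')
    refine hO.trans_isLittleO ?_
    have : (fun h : E => ‖h‖ ^ 2) =o[𝓝 0] fun h => h :=
      Asymptotics.isLittleO_norm_pow_id one_lt_two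
    have ht : Tendsto (fun x' : E => x' - x) (𝓝 x) (𝓝 0) := by
      have : Continuous fun x' : E => x' - x := by fun_prop
      simpa using this.tendsto x
    exact this.comp_tendsto ht
  · intro x y hy
    have h := le_supConv (s := s) hD hu (P x) hy
    simp only [hU]
    -- This is `(α + β)²/(δ + ε) ≤ α²/δ + β²/ε`, which reduces to `(αε - δβ)² ≥ 0`.
    have key : ‖P x - y‖ ^ 2 / s ≤ ‖x - P x‖ ^ 2 / δ + ‖x - y‖ ^ 2 / ε := by
      have h1 : ‖P x - y‖ ≤ ‖x - P x‖ + ‖x - y‖ := by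
        rw [norm_sub_rev x (P x)]
        exact norm_sub_le_norm_sub_add_norm_sub _ _ _
      have h2 : ‖P x - y‖ ^ 2 ≤ (‖x - P x‖ + ‖x - y‖) ^ 2 := by gcongr
      generalize ‖x - P x‖ = α at *
      generalize ‖x - y‖ = β at *
      rw [div_add_div _ _ hδ.ne' hε.ne', div_le_div_iff₀ hs0 (by positivity)]
      calc _ ≤ (α + β) ^ 2 * (δ * ε) := by gcongr
        _ ≤ _ := by
          rw [hs]
          nlinarith [sq_nonneg (α * ε - δ * β)]
    have e1 : ‖P x - y‖ ^ 2 / (2 * s) = ‖P x - y‖ ^ 2 / s / 2 := by rw [div_div, mul_comm]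
    have e2 : ‖x - P x‖ ^ 2 / (2 * δ) = ‖x - P x‖ ^ 2 / δ / 2 := by rw [div_div, mul_comm]
    have e3 : ‖x - y‖ ^ 2 / (2 * ε) = ‖x - y‖ ^ 2 / ε / 2 := by rw [div_div, mul_comm]
    rw [e1] at h
    rw [e2, e3]
    linarith
  · intro x
    obtain ⟨y, hy, h⟩ := exists_supConv_eq (s := s) hD hne hu x
    refine ⟨y, hy, ?_⟩
    rw [← h]
    have := hP x x
    simpa using this
  · intro x
    obtain ⟨y, hy, h⟩ := exists_supConv_eq (s := s) hD hne hu (P x)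
    -- The point of the segment from `P x` to `y` where `(x' - P x)/δ = (y - x')/ε`. There `P x` is
    -- still the minimiser, and the two penalties combine into the single penalty of parameter `ε`.
    set x' := P x + (δ / s) • (y - P x) with hx'
    have hmin : ∀ w, f (P x) + ‖x' - P x‖ ^ 2 / (2 * δ) ≤ f w + ‖x' - w‖ ^ 2 / (2 * δ) ∧
        f (P x) + ‖x' - P x‖ ^ 2 / (2 * δ) = u y - ‖x' - y‖ ^ 2 / (2 * ε) := by
      have hid : ∀ w, ‖x' - w‖ ^ 2 = (1 - δ / s) * ‖w - P x‖ ^ 2 + δ / s * ‖w - y‖ ^ 2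
          - δ / s * (1 - δ / s) * ‖y - P x‖ ^ 2 := fun w => by
        rw [norm_sub_rev, norm_sub_lineMap_sq]
      have hxy : ‖x' - y‖ ^ 2 = (1 - δ / s) ^ 2 * ‖y - P x‖ ^ 2 := by
        rw [hid y]; simp; ring_nf
      have hxP : ‖x' - P x‖ ^ 2 = (δ / s) ^ 2 * ‖y - P x‖ ^ 2 := by
        rw [hid (P x), norm_sub_rev (P x) y]; simp; ring_nf
      have heq : f (P x) + ‖x' - P x‖ ^ 2 / (2 * δ) = u y - ‖x' - y‖ ^ 2 / (2 * ε) := by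
        rw [hf, h, hxy, hxP, norm_sub_rev (P x) y, hs]
        field_simp
        ring
      intro w
      refine ⟨?_, heq⟩
      rw [heq, hxy, hid w]
      have hw := le_supConv (s := s) hD hu w hy
      have hn : 0 ≤ ε / (2 * δ * s) * ‖w - P x‖ ^ 2 := by positivity
      have e : ((1 - δ / s) * ‖w - P x‖ ^ 2 + δ / s * ‖w - y‖ ^ 2
          - δ / s * (1 - δ / s) * ‖y - P x‖ ^ 2) / (2 * δ) =
          ε / (2 * δ * s) * ‖w - P x‖ ^ 2 + ‖w - y‖ ^ 2 / (2 * s)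
          - (1 - δ / s) ^ 2 * ‖y - P x‖ ^ 2 / (2 * ε) := by
        rw [hs]; field_simp; ring
      rw [e]
      linarith
    have hPx' : P x' = P x := hPu x' (P x) fun w => (hmin w).1
    refine ⟨y, hy, x', ?_, fun t ht0 ht1 => ?_⟩
    · simp only [hU]
      rw [hPx']
      exact (hmin 0).2
    -- Once the square of the base point cancels, optimality of `P x` against `w` is affine in the
    -- base point, so it passes from `x` and `x'` to the whole segment.
    · refine hPu _ _ fun w => ?_
      have hid : ∀ z, ‖x + t • (x' - x) - z‖ ^ 2 = (1 - t) * ‖x - z‖ ^ 2 + t * ‖x' - z‖ ^ 2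
          - t * (1 - t) * ‖x' - x‖ ^ 2 := fun z => by
        rw [norm_sub_rev, norm_sub_lineMap_sq, norm_sub_rev z x, norm_sub_rev z x']
      have h1 := mul_le_mul_of_nonneg_left (hP x w) (sub_nonneg.2 ht1)
      have h2 := mul_le_mul_of_nonneg_left (hmin w).1 ht0
      rw [hid, hid]
      simp only [sub_div, add_div, mul_div_assoc, mul_add] at h1 h2 ⊢
      linarith

end Regularization

/-! ### Second order expansions, a Jensen-type lemma, and the equation for the regularisation. -/

section SecondOrder

variable {E : Type*} [NormedAddCommGroup E] [InnerProductSpace ℝ E]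

/-- The derivative of a gradient field is symmetric. -/
theorem inner_symm_of_hasFDerivAt_grad {f : E → ℝ} {G : E → E} {T : E →L[ℝ] E} {x : E}
    (hf : ∀ y, HasFDerivAt f (innerSL ℝ (G y)) y) (hG : HasFDerivAt G T x) (h k : E) :
    inner ℝ (T h) k = inner ℝ h (T k) := by
  have h1 : HasFDerivAt (fun y => innerSL ℝ (G y))
      ((innerSL ℝ (E := E) : E →L[ℝ] E →L[ℝ] ℝ).comp T) x :=
    (innerSL ℝ (E := E) : E →L[ℝ] E →L[ℝ] ℝ).hasFDerivAt.comp x hG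
  have h2 := second_derivative_symmetric hf h1 h k
  simp only [ContinuousLinearMap.comp_apply] at h2
  rw [real_inner_comm (T k) h]
  exact h2

/-- Second order Taylor expansion of a function whose gradient is differentiable at one point. -/
theorem taylor_two_of_hasFDerivAt_grad {f : E → ℝ} {G : E → E} {T : E →L[ℝ] E} {x : E}
    (hf : ∀ y, HasFDerivAt f (innerSL ℝ (G y)) y) (hG : HasFDerivAt G T x) {η : ℝ} (hη : 0 < η) :
    ∀ᶠ y in 𝓝 x, |f y - f x - inner ℝ (G x) (y - x) - 1 / 2 * inner ℝ (T (y - x)) (y - x)|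
      ≤ η * ‖y - x‖ ^ 2 := by
  have hsymm := inner_symm_of_hasFDerivAt_grad hf hG
  have hlit := hG.isLittleO.def hη
  obtain ⟨r, hr, hball⟩ := Metric.eventually_nhds_iff_ball.1 hlit
  refine Metric.eventually_nhds_iff_ball.2 ⟨r, hr, fun y hy => ?_⟩
  -- The Taylor remainder `q` has gradient `G z - G x - T(z - x)`, by symmetry of `T`. This is at
  -- most `η|y - x|` on the segment, so the mean value inequality suffices.
  set q : E → ℝ := fun z => f z - inner ℝ (G x) (z - x) - 1 / 2 * inner ℝ (T (z - x)) (z - x)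
    with hq
  have hder : ∀ z, HasFDerivAt q (innerSL ℝ (G z - G x - T (z - x))) z := by
    intro z
    have hid : HasFDerivAt (fun z : E => z - x) (ContinuousLinearMap.id ℝ E) z :=
      (hasFDerivAt_id z).sub_const x
    have h1 : HasFDerivAt (fun z : E => inner ℝ (G x) (z - x)) (innerSL ℝ (G x)) z := by
      have h := (innerSL ℝ (G x)).hasFDerivAt.comp z hid
      rw [ContinuousLinearMap.comp_id] at h
      exact h
    have h2 : HasFDerivAt (fun z : E => T (z - x)) T z := by
      have h := T.hasFDerivAt.comp z hid
      rw [ContinuousLinearMap.comp_id] at h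
      exact h
    have h3 := (h2.inner ℝ hid).const_mul (1 / 2)
    refine (((hf z).sub h1).sub h3).congr_fderiv ?_
    ext k
    simp only [sub_apply, innerSL_apply_apply, smul_apply,
      ContinuousLinearMap.comp_apply, ContinuousLinearMap.prod_apply, fderivInnerCLM_apply,
      ContinuousLinearMap.id_apply, smul_eq_mul, inner_sub_left]
    rw [hsymm k (z - x), real_inner_comm (T (z - x)) k]
    ring
  have hseg : ∀ z ∈ segment ℝ x y, ‖z - x‖ ≤ ‖y - x‖ := by
    intro z hz
    obtain ⟨t, ⟨ht0, ht1⟩, rfl⟩ := (segment_eq_image' ℝ x y) ▸ hz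
    rw [add_sub_cancel_left, norm_smul, Real.norm_of_nonneg ht0]
    exact mul_le_of_le_one_left (norm_nonneg _) ht1
  have hmv := (convex_segment x y).norm_image_sub_le_of_norm_hasFDerivWithin_le
    (f := q) (C := η * ‖y - x‖) (fun z _ => (hder z).hasFDerivWithinAt) (fun z hz => ?_)
    (left_mem_segment ℝ x y) (right_mem_segment ℝ x y)
  · have e : q y - q x = f y - f x - inner ℝ (G x) (y - x)
        - 1 / 2 * inner ℝ (T (y - x)) (y - x) := by
      simp only [hq, sub_self, inner_zero_right]
      ring
    rw [e, Real.norm_eq_abs] at hmv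
    calc _ ≤ _ := hmv
      _ = _ := by ring
  · rw [innerSL_apply_norm]
    have hzb : z ∈ Metric.ball x r := by
      rw [Metric.mem_ball, dist_eq_norm] at hy ⊢
      exact (hseg z hz).trans_lt hy
    exact (hball z hzb).trans (mul_le_mul_of_nonneg_left (hseg z hz) hη.le)

/-- Second order necessary condition for a maximum. -/
theorem inner_apply_nonpos_of_isLocalMax {f : E → ℝ} {G : E → E} {T : E →L[ℝ] E} {x p : E}
    (hf : ∀ y, HasFDerivAt f (innerSL ℝ (G y)) y) (hG : HasFDerivAt G T x)
    (hmax : IsLocalMax (fun y => f y - inner ℝ p y) x) (h : E) : inner ℝ (T h) h ≤ 0 := by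
  have hp : G x = p := by
    have h1 : HasFDerivAt (fun y => f y - inner ℝ p y) (innerSL ℝ (G x) - innerSL ℝ p) x :=
      (hf x).sub (innerSL ℝ p).hasFDerivAt
    have h2 := hmax.hasFDerivAt_eq_zero h1
    have h3 := congrArg (fun l : E →L[ℝ] ℝ => l (G x - p)) h2
    simp only [sub_apply, innerSL_apply_apply, zero_apply,
      ← inner_sub_left] at h3
    exact sub_eq_zero.1 (inner_self_eq_zero.1 h3)
  suffices H : ∀ η : ℝ, 0 < η → inner ℝ (T h) h ≤ 0 + η by exact le_of_forall_pos_le_add H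
  intro η hη
  have hη' : 0 < η / (2 * (‖h‖ ^ 2 + 1)) := by positivity
  have ht : Tendsto (fun t : ℝ => x + t • h) (𝓝[>] 0) (𝓝 x) := by
    have : Continuous fun t : ℝ => x + t • h := by fun_prop
    simpa using (this.tendsto 0).mono_left nhdsWithin_le_nhds
  obtain ⟨t, ⟨h1, h2⟩, ht0⟩ := (((ht.eventually (taylor_two_of_hasFDerivAt_grad hf hG hη')).and
    (ht.eventually hmax)).and self_mem_nhdsWithin).exists
  have ht0 : 0 < t := ht0
  rw [hp] at h1
  simp only [add_sub_cancel_left, map_smul, inner_smul_left, inner_smul_right, norm_smul,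
    conj_trivial, Real.norm_of_nonneg ht0.le, inner_add_right] at h1 h2
  have h3 := (abs_le.1 h1).1
  have h4 : t ^ 2 * inner ℝ (T h) h ≤ t ^ 2 * (η / (‖h‖ ^ 2 + 1) * ‖h‖ ^ 2) := by
    have e : η / (2 * (‖h‖ ^ 2 + 1)) * (t * ‖h‖) ^ 2
      = t ^ 2 * (η / (‖h‖ ^ 2 + 1) * ‖h‖ ^ 2) / 2 := by
      field_simp
    rw [e] at h3
    linarith
  have h5 := le_of_mul_le_mul_left h4 (by positivity)
  have h6 : η / (‖h‖ ^ 2 + 1) * ‖h‖ ^ 2 ≤ η := by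
    rw [div_mul_eq_mul_div, div_le_iff₀ (by positivity)]
    nlinarith [sq_nonneg ‖h‖]
  linarith

/-- If `w` has Lipschitz gradient and a strict maximum inside a ball, the points at which tilts of
`w` have a local maximum are not contained in a null set. -/
theorem exists_isLocalMax_sub_inner [FiniteDimensional ℝ E] [MeasurableSpace E] [BorelSpace E]
    (μ : Measure E) [μ.IsAddHaarMeasure] {w : E → ℝ} {G : E → E} {x₀ : E} {r m : ℝ} {C : NNReal}
    (hr : 0 < r) (hm : 0 < m)
    (hw : ∀ y, HasFDerivAt w (innerSL ℝ (G y)) y)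
    (hG : LipschitzOnWith C G (Metric.closedBall x₀ r))
    (hbd : ∀ y ∈ Metric.sphere x₀ r, w y + m ≤ w x₀) {N : Set E} (hN : μ N = 0) :
    ∃ x ∈ Metric.ball x₀ r, x ∉ N ∧ ∃ p, IsLocalMax (fun y => w y - inner ℝ p y) x := by
  by_contra! hcon
  have hcont : Continuous w := continuous_iff_continuousAt.2 fun y => (hw y).continuousAt
  -- Every slope `p` with `|p| < m/r` is too small to push the maximum to the sphere, so it is the
  -- gradient at an interior maximum.
  have hsub : Metric.ball (0 : E) (m / r) ⊆ G '' (N ∩ Metric.closedBall x₀ r) := by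
    intro p hp
    rw [mem_ball_zero_iff, lt_div_iff₀ hr] at hp
    obtain ⟨x, hx, hmax⟩ := (isCompact_closedBall x₀ r).exists_isMaxOn
      ⟨x₀, Metric.mem_closedBall_self hr.le⟩
      (f := fun y => w y - inner ℝ p y) (by fun_prop)
    have hxb : x ∈ Metric.ball x₀ r := by
      rw [Metric.mem_ball]
      refine lt_of_le_of_ne hx fun hs => ?_
      have h1 := hbd x hs
      have h2 : w x₀ - inner ℝ p x₀ ≤ w x - inner ℝ p x :=
        hmax (Metric.mem_closedBall_self hr.le)
      have h3 : |inner ℝ p (x - x₀)| ≤ ‖p‖ * ‖x - x₀‖ := abs_real_inner_le_norm _ _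
      rw [dist_eq_norm] at hs
      rw [hs, inner_sub_right] at h3
      have := (abs_le.1 h3).1
      linarith
    have hloc : IsLocalMax (fun y => w y - inner ℝ p y) x :=
      (hmax.on_subset Metric.ball_subset_closedBall).isLocalMax (Metric.isOpen_ball.mem_nhds hxb)
    refine ⟨x, ⟨?_, hx⟩, ?_⟩
    · by_contra hxN
      exact hcon x hxb hxN p hloc
    · have h1 : HasFDerivAt (fun y => w y - inner ℝ p y) (innerSL ℝ (G x) - innerSL ℝ p) x :=
        (hw x).sub (innerSL ℝ p).hasFDerivAt
      have h2 := hloc.hasFDerivAt_eq_zero h1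
      have h3 := congrArg (fun l : E →L[ℝ] ℝ => l (G x - p)) h2
      simp only [sub_apply, innerSL_apply_apply,
        zero_apply, ← inner_sub_left] at h3
      exact sub_eq_zero.1 (inner_self_eq_zero.1 h3)
  -- A Lipschitz map sends null sets to null sets; this passes through Hausdorff measure, which has
  -- the same null sets as `μ`.
  have hnull : μ (G '' (N ∩ Metric.closedBall x₀ r)) = 0 := by
    have hH : μH[(Module.finrank ℝ E : ℝ)] (N ∩ Metric.closedBall x₀ r) = 0 :=
      Measure.absolutelyContinuous_isAddHaarMeasure _ μ (measure_mono_null inter_subset_left hN)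
    refine Measure.absolutelyContinuous_isAddHaarMeasure μ μH[(Module.finrank ℝ E : ℝ)] ?_
    have := (hG.mono (inter_subset_right (s := N))).hausdorffMeasure_image_le
      (d := (Module.finrank ℝ E : ℝ)) (by positivity)
    rw [hH, mul_zero] at this
    exact le_antisymm this zero_le
  have hpos : 0 < μ (Metric.ball (0 : E) (m / r)) := Metric.measure_ball_pos μ _ (by positivity)
  exact hpos.ne' (measure_mono_null hsub hnull)

/-- Uniform ellipticity for a function of a symmetric operator. -/
def IsEllipticOperator (lam Lam : ℝ) (F : (E →L[ℝ] E) → ℝ) : Prop :=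
  ∀ S N : E →L[ℝ] E, (∀ h k, inner ℝ (S h) k = inner ℝ h (S k)) →
    (∀ h k, inner ℝ (N h) k = inner ℝ h (N k)) → (∀ h, 0 ≤ inner ℝ (N h) h) →
    lam * ‖N‖ ≤ F (S + N) - F S ∧ F (S + N) - F S ≤ Lam * ‖N‖

/-- `u` satisfies `F(D²u) ≥ 0` at `y` when tested with quadratic polynomials. -/
def IsQuadraticSubsolutionAt (F : (E →L[ℝ] E) → ℝ) (u : E → ℝ) (y : E) : Prop :=
  ∀ (b : E) (S : E →L[ℝ] E), (∀ h k, inner ℝ (S h) k = inner ℝ h (S k)) →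
    IsLocalMax (fun z => u z - (inner ℝ b (z - y) + 1 / 2 * inner ℝ (S (z - y)) (z - y))) y →
    0 ≤ F S

theorem IsEllipticOperator.add_smul_id_le {lam Lam : ℝ} {F : (E →L[ℝ] E) → ℝ} (hLam : 0 ≤ Lam)
    (hF : IsEllipticOperator lam Lam F) {S : E →L[ℝ] E}
    (hS : ∀ h k, inner ℝ (S h) k = inner ℝ h (S k)) {t : ℝ} (ht : 0 ≤ t) :
    F (S + t • ContinuousLinearMap.id ℝ E) ≤ F S + Lam * t := by
  have h := (hF S (t • ContinuousLinearMap.id ℝ E) hS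
    (fun h k => by simp [inner_smul_left, inner_smul_right])
    (fun h => by simpa [inner_smul_left] using mul_nonneg ht real_inner_self_nonneg)).2
  have h2 : ‖t • ContinuousLinearMap.id ℝ E‖ ≤ t := by
    rw [norm_smul, Real.norm_of_nonneg ht]
    exact mul_le_of_le_one_right ht ContinuousLinearMap.norm_id_le
  have := mul_le_mul_of_nonneg_left h2 hLam
  linarith

/-- A double regularisation of a subsolution satisfies the equation at points of second order
differentiability. -/
theorem subsolution_sup_inf_convolution {lam Lam : ℝ} (hlam : 0 ≤ lam) (hLam : 0 ≤ Lam)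
    {F : (E →L[ℝ] E) → ℝ} (hF : IsEllipticOperator lam Lam F) {D : Set E} {u U : E → ℝ}
    {P : E → E} {ε δ : ℝ} (hε : 0 < ε) (hδ : 0 < δ) (hF0 : 0 ≤ F 0 - Lam / ε + lam / δ)
    (hPlip : LipschitzWith (Real.toNNReal ((ε + δ) / ε)) P)
    (hU : ∀ x, HasFDerivAt U (innerSL ℝ ((1 / δ) • (x - P x))) x)
    (hUu : ∀ x, ∀ y ∈ D, u y - ‖x - y‖ ^ 2 / (2 * ε) ≤ U x)
    (hcontact : ∀ x, ∃ y ∈ D, ∃ x', U x' = u y - ‖x' - y‖ ^ 2 / (2 * ε) ∧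
      ∀ t : ℝ, 0 ≤ t → t ≤ 1 → P (x + t • (x' - x)) = P x)
    {x : E} {L : E →L[ℝ] E} (hL : HasFDerivAt P L x)
    (hsub : ∀ y ∈ D, U x = u y - ‖x - y‖ ^ 2 / (2 * ε) →
      D ∈ 𝓝 y ∧ IsQuadraticSubsolutionAt F u y) :
    0 ≤ F ((1 / δ) • (ContinuousLinearMap.id ℝ E - L)) := by
  set T : E →L[ℝ] E := (1 / δ) • (ContinuousLinearMap.id ℝ E - L) with hT
  have hG : HasFDerivAt (fun x => (1 / δ) • (x - P x)) T x :=
    ((hasFDerivAt_id x).sub hL).const_smul (1 / δ)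
  have hTs := inner_symm_of_hasFDerivAt_grad hU hG
  obtain ⟨y, hy, x', hx', hseg⟩ := hcontact x
  -- If `x' = x`, then `U` touches a sup-convolution of `u` at `x` and the inequality comes from `u`
  -- at `y`. Otherwise `P` is constant on a segment, and the curvature `1/δ` in that direction alone
  -- makes `F T` nonnegative.
  by_cases hxx : x' = x
  · rw [hxx] at hx'
    obtain ⟨hDy, hq⟩ := hsub y hy hx'
    suffices H : ∀ η : ℝ, 0 < η → 0 ≤ F T + η by exact le_of_forall_pos_le_add H
    intro η hη
    -- Raising the Hessian by `2θ` absorbs the Taylor error `θ|h|²` and costs at most `2θ Lam ≤ η`.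
    set θ := η / (2 * (Lam + 1)) with hθ
    have hθ0 : 0 < θ := by positivity
    have hS : ∀ h k, inner ℝ ((T + (2 * θ) • ContinuousLinearMap.id ℝ E) h) k
        = inner ℝ h ((T + (2 * θ) • ContinuousLinearMap.id ℝ E) k) := by
      intro h k
      simp [inner_add_left, inner_add_right, hTs h k, inner_smul_left, inner_smul_right]
    have h1 : 0 ≤ F (T + (2 * θ) • ContinuousLinearMap.id ℝ E) := by
      refine hq ((1 / δ) • (x - P x)) _ hS ?_
      have ht : Tendsto (fun z : E => x + (z - y)) (𝓝 y) (𝓝 x) := by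
        have : Continuous fun z : E => x + (z - y) := by fun_prop
        simpa using this.tendsto y
      -- Translating `x` along with `z - y` keeps the penalty `|x - y|²/(2ε)` fixed, so the
      -- expansion of `U` at `x` bounds `u` near `y`.
      filter_upwards [hDy, ht.eventually (taylor_two_of_hasFDerivAt_grad hU hG hθ0)]
        with z hz hz2
      have h3 := hUu (x + (z - y)) z hz
      have e : x + (z - y) - z = x - y := by abel
      rw [e] at h3
      rw [add_sub_cancel_left] at hz2
      have h4 := (abs_le.1 hz2).2
      simp only [sub_self, inner_zero_right, add_apply, inner_add_left,
        smul_apply, ContinuousLinearMap.id_apply, map_zero, inner_smul_left,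
        conj_trivial, real_inner_self_eq_norm_sq] at h4 ⊢
      linarith
    have h2 := hF.add_smul_id_le hLam hTs (t := 2 * θ) (by positivity)
    have h3 : Lam * (2 * θ) ≤ η := by
      rw [hθ]
      have : Lam * (2 * (η / (2 * (Lam + 1)))) = η * (Lam / (Lam + 1)) := by field_simp
      rw [this]
      exact mul_le_of_le_one_right hη.le ((div_le_one (by linarith)).2 (by linarith))
    linarith
  · set e := x' - x with he
    have he0 : e ≠ 0 := sub_ne_zero.2 hxx
    have hLe : L e = 0 := by
      have hline : HasDerivAt (fun t : ℝ => P (x + t • e)) (L e) 0 := by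
        have h1 : HasDerivAt (fun t : ℝ => x + t • e) e 0 := by
          simpa using ((hasDerivAt_id (0 : ℝ)).smul_const e).const_add x
        have h2 : HasFDerivAt P L (x + (0 : ℝ) • e) := by simpa using hL
        exact h2.comp_hasDerivAt (0 : ℝ) h1
      have h0 : HasDerivWithinAt (fun t : ℝ => P (x + t • e)) 0 (Icc 0 1) 0 := by
        refine (hasDerivWithinAt_const (0 : ℝ) (Icc 0 1) (P x)).congr (fun t ht => ?_) ?_
        · exact hseg t ht.1 ht.2
        · simp
      exact (uniqueDiffOn_Icc_zero_one 0 (by simp)).eq_deriv _ hline.hasDerivWithinAt h0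
    have hLn : ‖L‖ ≤ (ε + δ) / ε := by
      have := hL.le_of_lipschitz hPlip
      rwa [Real.coe_toNNReal _ (by positivity)] at this
    set N : E →L[ℝ] E := T + (1 / ε) • ContinuousLinearMap.id ℝ E with hNdef
    have hNapp : ∀ h, N h = (1 / δ) • (h - L h) + (1 / ε) • h := fun h => by simp [hNdef, hT]
    have hNs : ∀ h k, inner ℝ (N h) k = inner ℝ h (N k) := by
      intro h k
      simp [hNdef, inner_add_left, inner_add_right, hTs h k, inner_smul_left, inner_smul_right]
    have hNp : ∀ h, 0 ≤ inner ℝ (N h) h := by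
      intro h
      have h1 : inner ℝ (L h) h ≤ (ε + δ) / ε * ‖h‖ ^ 2 := by
        calc inner ℝ (L h) h ≤ ‖L h‖ * ‖h‖ := real_inner_le_norm _ _
          _ ≤ (‖L‖ * ‖h‖) * ‖h‖ := by gcongr; exact L.le_opNorm h
          _ ≤ ((ε + δ) / ε * ‖h‖) * ‖h‖ := by gcongr
          _ = _ := by ring
      rw [hNapp]
      simp only [inner_add_left, inner_smul_left, inner_sub_left, conj_trivial,
        real_inner_self_eq_norm_sq]
      have h2 := mul_le_mul_of_nonneg_left h1 (one_div_pos.2 hδ).le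
      have h3 : 1 / δ * ((ε + δ) / ε * ‖h‖ ^ 2) = 1 / δ * ‖h‖ ^ 2 + 1 / ε * ‖h‖ ^ 2 := by
        field_simp
      linarith
    have hNn : 1 / δ ≤ ‖N‖ := by
      have h1 := N.le_opNorm e
      rw [hNapp, hLe, sub_zero, ← add_smul, norm_smul, Real.norm_of_nonneg (by positivity)] at h1
      have h2 := le_of_mul_le_mul_right h1 (norm_pos_iff.2 he0)
      have : 0 < 1 / ε := by positivity
      linarith
    -- Since `T = S + N` with `N ≥ 0` and `‖N‖ ≥ 1/δ`, ellipticity gives `F T ≥ F S + lam/δ ≥ F 0 -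
    -- Lam/ε + lam/δ`.
    set S : E →L[ℝ] E := -((1 / ε) • ContinuousLinearMap.id ℝ E) with hSdef
    have hSs : ∀ h k, inner ℝ (S h) k = inner ℝ h (S k) := by
      intro h k
      simp [hSdef, inner_smul_left, inner_smul_right]
    have h1 := (hF S N hSs hNs hNp).1
    have h2 := hF.add_smul_id_le hLam hSs (t := 1 / ε) (by positivity)
    have e1 : S + N = T := by simp [hSdef, hNdef]
    have e2 : S + (1 / ε) • ContinuousLinearMap.id ℝ E = 0 := by simp [hSdef]
    rw [e1] at h1
    rw [e2] at h2
    have h3 := mul_le_mul_of_nonneg_left hNn hlam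
    have e3 : Lam * (1 / ε) = Lam / ε := by ring
    have e4 : lam * (1 / δ) = lam / δ := by ring
    linarith

end SecondOrder

/-! ### Weak derivatives and mollification of test functions. -/

section Sobolev

variable {d : ℕ} {Ω : Set (EuclideanSpace ℝ (Fin d))} {p : ℝ≥0∞}

theorem MemLpLoc.add {f g : EuclideanSpace ℝ (Fin d) → ℝ} (hf : MemLpLoc p Ω f)
    (hg : MemLpLoc p Ω g) : MemLpLoc p Ω (fun x => f x + g x) :=
  fun K hK hKΩ => (hf K hK hKΩ).add (hg K hK hKΩ)

theorem MemLpLoc.const_mul {f : EuclideanSpace ℝ (Fin d) → ℝ} (hf : MemLpLoc p Ω f) (c : ℝ) :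
    MemLpLoc p Ω (fun x => c * f x) :=
  fun K hK hKΩ => (hf K hK hKΩ).const_mul c

theorem Continuous.memLpLoc {f : EuclideanSpace ℝ (Fin d) → ℝ} (hf : Continuous f) :
    MemLpLoc p Ω f := by
  intro K hK _
  obtain ⟨C, hC⟩ := hK.exists_bound_of_continuousOn hf.continuousOn
  have : IsFiniteMeasure (volume.restrict K) := ⟨by simpa using hK.measure_lt_top⟩
  exact MemLp.of_bound hf.aestronglyMeasurable C
    ((ae_restrict_iff' hK.measurableSet).2 (Eventually.of_forall hC))

theorem MemLpLoc.integrable_mul {f η : EuclideanSpace ℝ (Fin d) → ℝ} (hf : MemLpLoc 1 Ω f)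
    (hη : Continuous η) (hc : HasCompactSupport η) (hs : tsupport η ⊆ Ω) :
    Integrable (fun x => f x * η x) := by
  have h1 : IntegrableOn f (tsupport η) := memLp_one_iff_integrable.1 (hf _ hc hs)
  have h2 : IntegrableOn (fun x => f x * η x) (tsupport η) :=
    h1.mul_continuousOn hη.continuousOn hc
  refine (integrableOn_iff_integrable_of_support_subset ?_).1 h2
  exact (Function.support_mul_subset_right _ _).trans (subset_tsupport η)

theorem ContDiff.fderiv_const_apply {f : EuclideanSpace ℝ (Fin d) → ℝ} (hf : ContDiff ℝ ∞ f)
    (v : EuclideanSpace ℝ (Fin d)) : ContDiff ℝ ∞ (fun x => fderiv ℝ f x v) :=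
  (hf.fderiv_right (m := ∞) (by simp)).clm_apply contDiff_const

theorem tsupport_fderiv_const_apply_subset (f : EuclideanSpace ℝ (Fin d) → ℝ)
    (v : EuclideanSpace ℝ (Fin d)) : tsupport (fun x => fderiv ℝ f x v) ⊆ tsupport f :=
  tsupport_fderiv_apply_subset ℝ v

theorem HasWeakPartialDeriv.add {i : Fin d} {f g f' g' : EuclideanSpace ℝ (Fin d) → ℝ}
    (h : HasWeakPartialDeriv Ω i f g) (h' : HasWeakPartialDeriv Ω i f' g') :
    HasWeakPartialDeriv Ω i (fun x => f x + f' x) (fun x => g x + g' x) := by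
  refine ⟨h.1.add h'.1, h.2.1.add h'.2.1, fun η hη hc hs => ?_⟩
  have hd := (hη.fderiv_const_apply (EuclideanSpace.single i 1)).continuous
  have hdc : HasCompactSupport (fun x => fderiv ℝ η x (EuclideanSpace.single i 1)) :=
    hc.fderiv_apply ℝ _
  have hds := (tsupport_fderiv_const_apply_subset η (EuclideanSpace.single i 1)).trans hs
  simp only [add_mul]
  rw [integral_add (h.1.integrable_mul hd hdc hds) (h'.1.integrable_mul hd hdc hds),
    integral_add (h.2.1.integrable_mul hη.continuous hc hs)
      (h'.2.1.integrable_mul hη.continuous hc hs), h.2.2 η hη hc hs, h'.2.2 η hη hc hs]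
  ring

theorem HasWeakPartialDeriv.const_mul {i : Fin d} {f g : EuclideanSpace ℝ (Fin d) → ℝ}
    (h : HasWeakPartialDeriv Ω i f g) (c : ℝ) :
    HasWeakPartialDeriv Ω i (fun x => c * f x) (fun x => c * g x) := by
  refine ⟨h.1.const_mul c, h.2.1.const_mul c, fun η hη hc hs => ?_⟩
  simp only [mul_assoc]
  rw [integral_const_mul, integral_const_mul, h.2.2 η hη hc hs]
  ring

theorem ContDiff.hasWeakPartialDeriv {f : EuclideanSpace ℝ (Fin d) → ℝ} (hf : ContDiff ℝ ∞ f)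
    (i : Fin d) :
    HasWeakPartialDeriv Ω i f (fun x => fderiv ℝ f x (EuclideanSpace.single i 1)) := by
  have hfd := (hf.fderiv_const_apply (EuclideanSpace.single i 1)).continuous
  refine ⟨hf.continuous.memLpLoc, hfd.memLpLoc, fun η hη hc hs => ?_⟩
  have hd := (hη.fderiv_const_apply (EuclideanSpace.single i 1)).continuous
  have hdc : HasCompactSupport (fun x => fderiv ℝ η x (EuclideanSpace.single i 1)) :=
    hc.fderiv_apply ℝ _
  have hfdiff : Differentiable ℝ f := hf.differentiable (by simp)
  have hηdiff : Differentiable ℝ η := hη.differentiable (by simp)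
  exact integral_mul_fderiv_eq_neg_fderiv_mul_of_integrable
    ((hfd.mul hη.continuous).integrable_of_hasCompactSupport hc.mul_left)
    ((hf.continuous.mul hd).integrable_of_hasCompactSupport hdc.mul_left)
    ((hf.continuous.mul hη.continuous).integrable_of_hasCompactSupport hc.mul_left)
    (fun x _ => hfdiff x) (fun x _ => hηdiff x)

/-- The Hessian matrix of a smooth function. -/
noncomputable def hessianMatrix (f : EuclideanSpace ℝ (Fin d) → ℝ)
    (x : EuclideanSpace ℝ (Fin d)) : Matrix (Fin d) (Fin d) ℝ :=
  Matrix.of fun i j => fderiv ℝ (fun y => fderiv ℝ f y (EuclideanSpace.single i 1)) x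
    (EuclideanSpace.single j 1)

theorem ContDiff.memW2pLocWithHessian {f : EuclideanSpace ℝ (Fin d) → ℝ} (hf : ContDiff ℝ ∞ f) :
    MemW2pLocWithHessian p Ω f (hessianMatrix f) := by
  refine ⟨hf.continuous.memLpLoc, fun i x => fderiv ℝ f x (EuclideanSpace.single i 1),
    fun i => ⟨(hf.fderiv_const_apply _).continuous.memLpLoc, hf.hasWeakPartialDeriv i⟩,
    fun i j => ⟨?_, ?_⟩⟩
  · exact ((hf.fderiv_const_apply _).fderiv_const_apply _).continuous.memLpLoc
  · exact (hf.fderiv_const_apply _).hasWeakPartialDeriv j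

theorem MemW2pLocWithHessian.add {f g : EuclideanSpace ℝ (Fin d) → ℝ}
    {H K : EuclideanSpace ℝ (Fin d) → Matrix (Fin d) (Fin d) ℝ}
    (hf : MemW2pLocWithHessian p Ω f H) (hg : MemW2pLocWithHessian p Ω g K) :
    MemW2pLocWithHessian p Ω (fun x => f x + g x) (fun x => H x + K x) := by
  obtain ⟨h1, G, h2, h3⟩ := hf
  obtain ⟨k1, G', k2, k3⟩ := hg
  exact ⟨h1.add k1, fun i x => G i x + G' i x,
    fun i => ⟨(h2 i).1.add (k2 i).1, (h2 i).2.add (k2 i).2⟩,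
    fun i j => ⟨(h3 i j).1.add (k3 i j).1, (h3 i j).2.add (k3 i j).2⟩⟩

theorem MemW2pLocWithHessian.const_mul {f : EuclideanSpace ℝ (Fin d) → ℝ}
    {H : EuclideanSpace ℝ (Fin d) → Matrix (Fin d) (Fin d) ℝ}
    (hf : MemW2pLocWithHessian p Ω f H) (c : ℝ) :
    MemW2pLocWithHessian p Ω (fun x => c * f x) (fun x => c • H x) := by
  obtain ⟨h1, G, h2, h3⟩ := hf
  exact ⟨h1.const_mul c, fun i x => c * G i x,
    fun i => ⟨(h2 i).1.const_mul c, (h2 i).2.const_mul c⟩,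
    fun i j => ⟨(h3 i j).1.const_mul c, (h3 i j).2.const_mul c⟩⟩

theorem fderiv_fderiv_apply_comm {f : EuclideanSpace ℝ (Fin d) → ℝ} (hf : ContDiff ℝ ∞ f)
    (x v w : EuclideanSpace ℝ (Fin d)) :
    fderiv ℝ (fun y => fderiv ℝ f y v) x w = fderiv ℝ (fun y => fderiv ℝ f y w) x v := by
  have hd : DifferentiableAt ℝ (fderiv ℝ f) x :=
    ((hf.fderiv_right (m := ∞) (by simp)).differentiable (by simp)) x
  have h1 : ∀ v w, fderiv ℝ (fun y => fderiv ℝ f y v) x w = fderiv ℝ (fderiv ℝ f) x w v := by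
    intro v w
    have := (hd.hasFDerivAt.clm_apply (hasFDerivAt_const v x)).fderiv
    rw [this]
    simp
  rw [h1, h1]
  exact second_derivative_symmetric (fun y => (hf.differentiable (by simp) y).hasFDerivAt)
    hd.hasFDerivAt w v

/-- The weak Hessian is symmetric almost everywhere. -/
theorem MemW2pLocWithHessian.ae_isSymm {f : EuclideanSpace ℝ (Fin d) → ℝ}
    {H : EuclideanSpace ℝ (Fin d) → Matrix (Fin d) (Fin d) ℝ}
    (hΩ : IsOpen Ω) (hf : MemW2pLocWithHessian p Ω f H) :
    ∀ᵐ x, x ∈ Ω → (H x).IsSymm := by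
  obtain ⟨-, G, h2, h3⟩ := hf
  have key : ∀ i j, ∀ᵐ x, x ∈ Ω → H x j i = H x i j := by
    intro i j
    have hint : ∀ i j, ∀ η : EuclideanSpace ℝ (Fin d) → ℝ, ContDiff ℝ ∞ η →
        HasCompactSupport η → tsupport η ⊆ Ω → ∫ x, H x i j * η x =
          ∫ x, f x * fderiv ℝ (fun y => fderiv ℝ η y (EuclideanSpace.single j 1)) x
            (EuclideanSpace.single i 1) := by
      intro i j η hη hc hs
      have h5 := (h3 i j).2.2.2 η hη hc hs
      have h6 := (h2 i).2.2.2 _ (hη.fderiv_const_apply (EuclideanSpace.single j 1))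
        (hc.fderiv_apply ℝ _) ((tsupport_fderiv_const_apply_subset η _).trans hs)
      rw [h6, h5, neg_neg]
    have hloc : ∀ i j, LocallyIntegrableOn (fun x => H x i j) Ω := by
      intro i j
      rw [locallyIntegrableOn_iff hΩ.isLocallyClosed]
      intro K hK hKc
      exact memLp_one_iff_integrable.1 ((h3 i j).2.2.1 _ hKc hK)
    -- Tested against `η`, both entries become integrals of `f` against second partials of `η`,
    -- which commute.
    have h7 := hΩ.ae_eq_zero_of_integral_contDiff_smul_eq_zero
      (f := fun x => H x j i - H x i j) (μ := volume) ((hloc j i).sub (hloc i j)) ?_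
    · filter_upwards [h7] with x hx hxΩ
      exact sub_eq_zero.1 (hx hxΩ)
    · intro η hη hc hs
      have e : (fun x => η x • (H x j i - H x i j)) = fun x => H x j i * η x - H x i j * η x := by
        ext x; simp only [smul_eq_mul]; ring
      rw [e, integral_sub ((h3 j i).2.2.1.integrable_mul hη.continuous hc hs)
        ((h3 i j).2.2.1.integrable_mul hη.continuous hc hs), hint j i η hη hc hs,
        hint i j η hη hc hs, sub_eq_zero]
      congr 1
      ext x
      rw [fderiv_fderiv_apply_comm hη]
  have : ∀ᵐ x, ∀ i j, x ∈ Ω → H x j i = H x i j :=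
    ae_all_iff.2 fun i => ae_all_iff.2 fun j => key i j
  filter_upwards [this] with x hx hxΩ
  ext i j
  exact hx i j hxΩ

theorem tsupport_comp_const_sub (η : EuclideanSpace ℝ (Fin d) → ℝ)
    (x : EuclideanSpace ℝ (Fin d)) :
    tsupport (fun y => η (x - y)) = (fun y => x - y) ⁻¹' tsupport η :=
  tsupport_comp_eq_preimage η (Homeomorph.subLeft x)

theorem HasCompactSupport.comp_const_sub {η : EuclideanSpace ℝ (Fin d) → ℝ}
    (hc : HasCompactSupport η) (x : EuclideanSpace ℝ (Fin d)) :
    HasCompactSupport (fun y => η (x - y)) :=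
  hc.comp_homeomorph (Homeomorph.subLeft x)

theorem fderiv_comp_const_sub {η : EuclideanSpace ℝ (Fin d) → ℝ} (hη : ContDiff ℝ ∞ η)
    (x y v : EuclideanSpace ℝ (Fin d)) :
    fderiv ℝ (fun y => η (x - y)) y v = - fderiv ℝ η (x - y) v := by
  have h1 : HasFDerivAt (fun y => x - y) (-ContinuousLinearMap.id ℝ _) y :=
    (hasFDerivAt_id y).const_sub x
  have h2 := ((hη.differentiable (by simp)) (x - y)).hasFDerivAt.comp y h1
  have h3 : fderiv ℝ (fun y => η (x - y)) y = _ := h2.fderiv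
  rw [h3]
  simp

/-- Weak differentiation under a reflected translation. -/
theorem HasWeakPartialDeriv.integral_mul_fderiv_const_sub {i : Fin d}
    {f g η : EuclideanSpace ℝ (Fin d) → ℝ}
    (h : HasWeakPartialDeriv Ω i f g) (hη : ContDiff ℝ ∞ η) (hc : HasCompactSupport η)
    {x : EuclideanSpace ℝ (Fin d)} (hs : (fun y => x - y) ⁻¹' tsupport η ⊆ Ω) :
    ∫ y, f y * fderiv ℝ η (x - y) (EuclideanSpace.single i 1) = ∫ y, g y * η (x - y) := by
  have h1 := h.2.2 (fun y => η (x - y)) (hη.comp (contDiff_const.sub contDiff_id))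
    (hc.comp_const_sub x) (by rwa [tsupport_comp_const_sub])
  simp only [fderiv_comp_const_sub hη, mul_neg, integral_neg, neg_inj] at h1
  exact h1

open Convolution in
theorem fderiv_convolution_mul_apply {g η : EuclideanSpace ℝ (Fin d) → ℝ}
    (hg : LocallyIntegrable g) (hη : ContDiff ℝ ∞ η) (hc : HasCompactSupport η)
    (x v : EuclideanSpace ℝ (Fin d)) :
    fderiv ℝ (g ⋆[ContinuousLinearMap.mul ℝ ℝ, volume] η) x v
      = (g ⋆[ContinuousLinearMap.mul ℝ ℝ, volume] fun y => fderiv ℝ η y v) x := by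
  have h1 : ContDiff ℝ 1 η := hη.of_le (by simp)
  rw [(hc.hasFDerivAt_convolution_right _ hg h1 x).fderiv,
    convolution_precompR_apply _ hg (hc.fderiv ℝ) (h1.continuous_fderiv one_ne_zero)]

open Convolution in
/-- Mollification of a `W^{2,p}_loc` function preserves convex constraints on the Hessian. -/
theorem MemW2pLocWithHessian.exists_contDiff_approx {f : EuclideanSpace ℝ (Fin d) → ℝ}
    {H : EuclideanSpace ℝ (Fin d) → Matrix (Fin d) (Fin d) ℝ}
    (hf : MemW2pLocWithHessian p Ω f H) (hfc : ContinuousOn f Ω)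
    {x₀ : EuclideanSpace ℝ (Fin d)} {r R : ℝ} (hrR : r < R)
    (hR : Metric.closedBall x₀ R ⊆ Ω) {𝒜 : Set (Matrix (Fin d) (Fin d) ℝ)} {c : ℝ}
    (hH : ∀ᵐ x, x ∈ Metric.ball x₀ R → ∀ A ∈ 𝒜, (A * H x).trace ≤ c) {τ : ℝ} (hτ : 0 < τ) :
    ∃ ψ : EuclideanSpace ℝ (Fin d) → ℝ, ContDiff ℝ ∞ ψ ∧
      (∀ x ∈ Metric.closedBall x₀ r, |ψ x - f x| ≤ τ) ∧
      ∀ x ∈ Metric.closedBall x₀ r, ∀ A ∈ 𝒜, (A * (hessianMatrix ψ x)ᵀ).trace ≤ c := by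
  obtain ⟨-, G, h2, h3⟩ := hf
  have hK : IsCompact (Metric.closedBall x₀ R) := isCompact_closedBall x₀ R
  obtain ⟨κ, hκ, hunif⟩ := Metric.uniformContinuousOn_iff_le.1
    (hK.uniformContinuousOn_of_continuous (hfc.mono hR)) τ hτ
  set ρ : ContDiffBump (0 : EuclideanSpace ℝ (Fin d)) :=
    ⟨min κ (R - r) / 4, min κ (R - r) / 2,
      by have := lt_min hκ (sub_pos.2 hrR); positivity,
      by have := lt_min hκ (sub_pos.2 hrR); linarith⟩ with hρ
  have hρout : ρ.rOut = min κ (R - r) / 2 := rfl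
  have hpos : 0 < min κ (R - r) := lt_min hκ (sub_pos.2 hrR)
  have hout1 : ρ.rOut < κ := by rw [hρout]; linarith [min_le_left κ (R - r)]
  have hout2 : ρ.rOut < R - r := by rw [hρout]; linarith [min_le_right κ (R - r)]
  set η := ρ.normed volume with hηdef
  have hη : ContDiff ℝ ∞ η := ρ.contDiff_normed
  have hc : HasCompactSupport η := ρ.hasCompactSupport_normed
  have hts : tsupport η = Metric.closedBall 0 ρ.rOut := ρ.tsupport_normed_eq
  -- Truncation makes the convolution globally defined. The kernel radius is below `R - r`, so on
  -- `closedBall x₀ r` the truncation is never seen.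
  set g := (Metric.closedBall x₀ R).indicator f with hgdef
  have hgint : Integrable g :=
    ((hfc.mono hR).integrableOn_compact hK).integrable_indicator hK.measurableSet
  have hg := hgint.locallyIntegrable
  have hsub : ∀ x ∈ Metric.closedBall x₀ r, (fun y => x - y) ⁻¹' tsupport η ⊆
      Metric.ball x₀ R := by
    intro x hx y hy
    rw [mem_preimage, hts, mem_closedBall_zero_iff] at hy
    rw [Metric.mem_closedBall, dist_eq_norm] at hx
    rw [Metric.mem_ball, dist_eq_norm]
    calc ‖y - x₀‖ ≤ ‖y - x‖ + ‖x - x₀‖ := norm_sub_le_norm_sub_add_norm_sub _ _ _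
      _ < R := by rw [norm_sub_rev y x]; linarith
  refine ⟨g ⋆[ContinuousLinearMap.mul ℝ ℝ, volume] η,
    hc.contDiff_convolution_right _ hg hη, fun x hx => ?_, fun x hx A hA => ?_⟩
  · have hflip : (g ⋆[ContinuousLinearMap.mul ℝ ℝ, volume] η)
        = η ⋆[ContinuousLinearMap.lsmul ℝ ℝ, volume] g := by
      rw [← convolution_flip]
      congr 1
      ext
      simp
    have hmem : ∀ y, dist y x ≤ ρ.rOut → y ∈ Metric.closedBall x₀ R := fun y hy => by
      have := Metric.mem_closedBall.1 hx
      exact Metric.mem_closedBall.2 ((dist_triangle y x x₀).trans (by linarith))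
    have hgx : g x = f x := indicator_of_mem (hmem x (by simpa using ρ.rOut_pos.le)) f
    rw [hflip, ← hgx, ← Real.dist_eq]
    refine ρ.dist_normed_convolution_le hgint.aestronglyMeasurable fun y hy => ?_
    have hy' := (Metric.mem_ball.1 hy).le
    rw [hgx, hgdef, indicator_of_mem (hmem y hy')]
    exact hunif y (hmem y hy') x (hmem x (by simpa using ρ.rOut_pos.le)) (hy'.trans hout1.le)
  · have hsx := hsub x hx
    have hsΩ := hsx.trans (Metric.ball_subset_closedBall.trans hR)
    have hηx : Continuous fun y => η (x - y) := hη.continuous.comp (by fun_prop)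
    have hcx : HasCompactSupport fun y => η (x - y) := hc.comp_const_sub x
    have hsx' : tsupport (fun y => η (x - y)) ⊆ Ω := by rwa [tsupport_comp_const_sub]
    -- Moving first `∂ᵢ` and then `∂ⱼ` from the kernel to `f` reverses the index order, which
    -- accounts for the transpose.
    have hHij : ∀ i j, hessianMatrix (g ⋆[ContinuousLinearMap.mul ℝ ℝ, volume] η) x j i
        = ∫ y, H y i j * η (x - y) := by
      intro i j
      have hηj := hη.fderiv_const_apply (EuclideanSpace.single j 1)
      have hcj : HasCompactSupport fun y => fderiv ℝ η y (EuclideanSpace.single j 1) :=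
        hc.fderiv_apply ℝ _
      have hsj := tsupport_fderiv_const_apply_subset η (EuclideanSpace.single j 1)
      have h4 := (h2 i).2.integral_mul_fderiv_const_sub hηj hcj (x := x)
        ((preimage_mono hsj).trans hsΩ)
      have h5 := (h3 i j).2.integral_mul_fderiv_const_sub hη hc (x := x) hsΩ
      rw [← h5, ← h4]
      simp only [hessianMatrix, Matrix.of_apply]
      have e : (fun y => fderiv ℝ (g ⋆[ContinuousLinearMap.mul ℝ ℝ, volume] η) y
          (EuclideanSpace.single j 1)) = g ⋆[ContinuousLinearMap.mul ℝ ℝ, volume]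
            fun y => fderiv ℝ η y (EuclideanSpace.single j 1) := by
        ext y
        exact fderiv_convolution_mul_apply hg hη hc y _
      rw [e, fderiv_convolution_mul_apply hg hηj hcj]
      rw [convolution_def]
      refine integral_congr_ae (Eventually.of_forall fun y => ?_)
      simp only [ContinuousLinearMap.mul_apply']
      by_cases hy : y ∈ Metric.closedBall x₀ R
      · rw [hgdef, indicator_of_mem hy]
      · have h0 : x - y ∉ tsupport fun y => fderiv ℝ (fun y => fderiv ℝ η y
            (EuclideanSpace.single j 1)) y (EuclideanSpace.single i 1) := fun h =>
          hy (Metric.ball_subset_closedBall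
            (hsx (hsj (tsupport_fderiv_const_apply_subset _ _ h))))
        have h1 := image_eq_zero_of_notMem_tsupport h0
        rw [h1, mul_zero, mul_zero]
    have hHint : ∀ i j, Integrable fun y => H y i j * η (x - y) := fun i j =>
      (h3 i j).2.2.1.integrable_mul hηx hcx hsx'
    have htr : (A * (hessianMatrix (g ⋆[ContinuousLinearMap.mul ℝ ℝ, volume] η) x)ᵀ).trace
        = ∫ y, (A * H y).trace * η (x - y) := by
      simp only [Matrix.trace, Matrix.diag_apply, Matrix.mul_apply, Matrix.transpose_apply, hHij,
        Finset.sum_mul, mul_assoc]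
      rw [integral_finsetSum _ fun i _ => integrable_finsetSum _ fun j _ =>
        (hHint j i).const_mul (A i j)]
      refine Finset.sum_congr rfl fun i _ => ?_
      rw [integral_finsetSum _ fun j _ => (hHint j i).const_mul (A i j)]
      exact Finset.sum_congr rfl fun j _ => (integral_const_mul _ _).symm
    have hone : ∫ y, η (x - y) = 1 := by
      rw [integral_sub_left_eq_self η volume x]
      exact ρ.integral_normed
    rw [htr]
    calc ∫ y, (A * H y).trace * η (x - y) ≤ ∫ y, c * η (x - y) := by
          refine integral_mono_ae ?_ ?_ ?_
          · have : (fun y => (A * H y).trace * η (x - y))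
                = fun y => ∑ i, ∑ j, A i j * (H y j i * η (x - y)) := by
              ext y
              simp only [Matrix.trace, Matrix.diag_apply, Matrix.mul_apply, Finset.sum_mul,
                mul_assoc]
            rw [this]
            exact integrable_finsetSum _ fun i _ => integrable_finsetSum _ fun j _ =>
              (hHint j i).const_mul (A i j)
          · exact (hηx.integrable_of_hasCompactSupport hcx).const_mul c
          · filter_upwards [hH] with y hy
            by_cases hyR : y ∈ Metric.ball x₀ R
            · exact mul_le_mul_of_nonneg_right (hy hyR A hA) (ρ.nonneg_normed _)
            · have : η (x - y) = 0 := image_eq_zero_of_notMem_tsupport fun h => hyR (hsx h)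
              simp [this]
      _ = c := by rw [integral_const_mul, hone, mul_one]

end Sobolev

/-! ### Choice of regularisation parameters. -/

section OperatorRegularization

variable {E : Type*} [NormedAddCommGroup E] [InnerProductSpace ℝ E] [ProperSpace E]

/-- A subsolution of a uniformly elliptic equation can be approximated from above by functions
with Lipschitz gradient that satisfy the equation where they are twice differentiable. -/
theorem exists_regularization_of_subsolution {lam Lam : ℝ} (hlam : 0 < lam) (hLam : lam ≤ Lam)
    {F : (E →L[ℝ] E) → ℝ} (hF : IsEllipticOperator lam Lam F) {u : E → ℝ} {x₀ : E} {r R : ℝ}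
    (hr : 0 < r) (hrR : r < R) (hu : ContinuousOn u (Metric.closedBall x₀ R))
    (hsub : ∀ y ∈ Metric.ball x₀ R, IsQuadraticSubsolutionAt F u y) {τ : ℝ} (hτ : 0 < τ) :
    ∃ (U : E → ℝ) (G : E → E), (∀ x, HasFDerivAt U (innerSL ℝ (G x)) x) ∧
      (∃ C, LipschitzWith C G) ∧
      (∀ x ∈ Metric.closedBall x₀ r, u x ≤ U x ∧ U x ≤ u x + τ) ∧
      ∀ x ∈ Metric.closedBall x₀ r, ∀ T, HasFDerivAt G T x → 0 ≤ F T := by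
  have hLam0 : 0 < Lam := hlam.trans_le hLam
  set D := Metric.closedBall x₀ R with hDdef
  have hD : IsCompact D := isCompact_closedBall x₀ R
  have hne : D.Nonempty := ⟨x₀, Metric.mem_closedBall_self (hr.trans hrR).le⟩
  obtain ⟨M, hM⟩ := hD.exists_bound_of_continuousOn hu
  have hM0 : 0 ≤ M := (norm_nonneg _).trans (hM _ hne.some_mem)
  obtain ⟨θ', hθ', hunif⟩ := Metric.uniformContinuousOn_iff_le.1
    (hD.uniformContinuousOn_of_continuous hu) τ hτ
  set θ := min θ' ((R - r) / 2) with hθ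
  have hθ0 : 0 < θ := lt_min hθ' (by linarith)
  -- The first bound keeps the relevant points `y` within `θ` of `x`. The second gives `Lam/ε ≥ |F
  -- 0| + 1`; as `δ` is chosen with `lam/δ = 2 Lam/ε`, it makes `F 0 - Lam/ε + lam/δ` nonnegative.
  set ε := min (θ ^ 2 / (8 * (M + 1))) (Lam / (|F 0| + 1)) with hε
  have hε0 : 0 < ε := lt_min (by positivity) (by positivity)
  have hε1 : 8 * (M + 1) * ε ≤ θ ^ 2 := by
    have := (le_div_iff₀ (by positivity)).1 (min_le_left (θ ^ 2 / (8 * (M + 1))) (Lam / (|F 0| + 1)))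
    linarith
  have hε2 : |F 0| + 1 ≤ Lam / ε := by
    rw [le_div_iff₀ hε0]
    have := (le_div_iff₀ (by positivity)).1
      (min_le_right (θ ^ 2 / (8 * (M + 1))) (Lam / (|F 0| + 1)))
    linarith
  set δ := lam / (2 * Lam) * ε with hδ
  have hδ0 : 0 < δ := by positivity
  have hδε : δ ≤ ε := by
    refine mul_le_of_le_one_left hε0.le ?_
    rw [div_le_one (by positivity)]
    linarith
  have hF0 : 0 ≤ F 0 - Lam / ε + lam / δ := by
    have e : lam / δ = 2 * (Lam / ε) := by
      rw [hδ]; field_simp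
    rw [e]
    linarith [neg_abs_le (F 0)]
  obtain ⟨U, P, hPlip, hU, hUu, hUle, hcontact⟩ :=
    exists_sup_inf_convolution hD hne hu hε0 hδ0
  have hsubset : ∀ x ∈ Metric.closedBall x₀ r, x ∈ D := fun x hx =>
    Metric.closedBall_subset_closedBall hrR.le hx
  have hge : ∀ x ∈ Metric.closedBall x₀ r, u x ≤ U x := fun x hx => by
    simpa using hUu x x (hsubset x hx)
  have hclose : ∀ x ∈ Metric.closedBall x₀ r, ∀ y ∈ D, ∀ t, 0 < t → t ≤ 2 * ε →
      U x ≤ u y - ‖x - y‖ ^ 2 / (2 * t) → dist y x ≤ θ := by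
    intro x hx y hy t ht0 ht h
    have h1 := hge x hx
    have h2 := (abs_le.1 (hM x (hsubset x hx))).1
    have h3 := (abs_le.1 (hM y hy)).2
    have h4 : ‖x - y‖ ^ 2 / (2 * t) ≤ 2 * M := by linarith
    rw [div_le_iff₀ (by positivity)] at h4
    have h5 : ‖x - y‖ ^ 2 ≤ θ ^ 2 := by nlinarith
    rw [dist_comm, dist_eq_norm]
    exact abs_le_of_sq_le_sq' h5 hθ0.le |>.2
  refine ⟨U, fun x => (1 / δ) • (x - P x), hU, ?_, fun x hx => ⟨hge x hx, ?_⟩, ?_⟩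
  · exact ⟨_, (lipschitzWith_smul (1 / δ)).comp (LipschitzWith.id.sub hPlip)⟩
  · obtain ⟨y, hy, h⟩ := hUle x
    have h1 := hclose x hx y hy (ε + δ) (by positivity) (by linarith) h
    have h2 := hunif y hy x (hsubset x hx) (h1.trans (min_le_left _ _))
    rw [Real.dist_eq] at h2
    have h3 := (abs_le.1 h2).2
    have h4 : 0 ≤ ‖x - y‖ ^ 2 / (2 * (ε + δ)) := by positivity
    linarith
  · intro x hx T hT
    have hP : HasFDerivAt P (ContinuousLinearMap.id ℝ E - δ • T) x := by
      have h := (hasFDerivAt_id x).sub (hT.const_smul δ)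
      refine h.congr_of_eventuallyEq (Eventually.of_forall fun z => ?_)
      simp [smul_smul, hδ0.ne']
    have h := subsolution_sup_inf_convolution hlam.le hLam0.le hF hε0 hδ0 hF0 hPlip hU hUu
      hcontact hP fun y hy hxy => ?_
    · convert h using 2
      rw [sub_sub_cancel, smul_smul, one_div, inv_mul_cancel₀ hδ0.ne', one_smul]
    · have h1 := hclose x hx y hy ε hε0 (by linarith) hxy.le
      have hyb : y ∈ Metric.ball x₀ R := by
        have h2 : dist y x ≤ (R - r) / 2 := h1.trans (min_le_right _ _)
        have h3 := Metric.mem_closedBall.1 hx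
        exact Metric.mem_ball.2 ((dist_triangle y x x₀).trans_lt (by linarith))
      exact ⟨mem_of_superset (Metric.isOpen_ball.mem_nhds hyb) Metric.ball_subset_closedBall,
        hsub y hyb⟩

end OperatorRegularization

/-! ### Passage between matrices and operators. -/

section MatrixOperator

variable {d : ℕ}

/-- The matrix of an operator on Euclidean space. -/
noncomputable abbrev operatorMatrix
    (T : EuclideanSpace ℝ (Fin d) →L[ℝ] EuclideanSpace ℝ (Fin d)) : Matrix (Fin d) (Fin d) ℝ :=
  (Matrix.toEuclideanCLM (n := Fin d) (𝕜 := ℝ)).symm T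

theorem operatorMatrix_apply (T : EuclideanSpace ℝ (Fin d) →L[ℝ] EuclideanSpace ℝ (Fin d))
    (i j : Fin d) : operatorMatrix T i j =
      inner ℝ (EuclideanSpace.single i 1) (T (EuclideanSpace.single j 1)) := by
  have h : Matrix.toEuclideanCLM (n := Fin d) (𝕜 := ℝ) (operatorMatrix T) = T :=
    StarAlgEquiv.apply_symm_apply _ _
  generalize operatorMatrix T = M at h ⊢
  subst h
  rw [EuclideanSpace.inner_single_left]
  simp

theorem isSymm_operatorMatrix {T : EuclideanSpace ℝ (Fin d) →L[ℝ] EuclideanSpace ℝ (Fin d)}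
    (hT : ∀ h k, inner ℝ (T h) k = inner ℝ h (T k)) : (operatorMatrix T).IsSymm := by
  ext i j
  rw [Matrix.transpose_apply, operatorMatrix_apply, operatorMatrix_apply, ← hT,
    real_inner_comm]

theorem posSemidef_operatorMatrix {T : EuclideanSpace ℝ (Fin d) →L[ℝ] EuclideanSpace ℝ (Fin d)}
    (hT : ∀ h k, inner ℝ (T h) k = inner ℝ h (T k)) (hp : ∀ h, 0 ≤ inner ℝ (T h) h) :
    (operatorMatrix T).PosSemidef := by
  refine Matrix.PosSemidef.of_dotProduct_mulVec_nonneg ?_ fun x => ?_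
  · simpa [Matrix.IsSymm, Matrix.IsHermitian] using isSymm_operatorMatrix hT
  · have h1 := Matrix.inner_toEuclideanCLM (operatorMatrix T) (WithLp.toLp 2 x) (WithLp.toLp 2 x)
    rw [operatorMatrix, StarAlgEquiv.apply_symm_apply] at h1
    have h2 := hp (WithLp.toLp 2 x)
    rw [real_inner_comm, h1] at h2
    simpa using h2

theorem IsElliptic.isEllipticOperator {lam Lam : ℝ} {F : Matrix (Fin d) (Fin d) ℝ → ℝ}
    (hF : IsElliptic lam Lam F) : IsEllipticOperator lam Lam fun T => F (operatorMatrix T) := by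
  intro S N hS hN hNp
  have h := hF (operatorMatrix S) (operatorMatrix N) (isSymm_operatorMatrix hS)
    (posSemidef_operatorMatrix hN hNp)
  rw [operatorMatrix, operatorMatrix, StarAlgEquiv.apply_symm_apply, ← map_add] at h
  exact h

/-- A quadratic polynomial is smooth, and its Hessian matrix is the matrix of the quadratic form. -/
theorem contDiff_quadratic (b y : EuclideanSpace ℝ (Fin d))
    (S : EuclideanSpace ℝ (Fin d) →L[ℝ] EuclideanSpace ℝ (Fin d)) :
    ContDiff ℝ ∞ fun z => inner ℝ b (z - y) + 1 / 2 * inner ℝ (S (z - y)) (z - y) := by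
  have h : ContDiff ℝ ∞ fun z : EuclideanSpace ℝ (Fin d) => z - y :=
    contDiff_id.sub contDiff_const
  exact (contDiff_const.inner ℝ h).add
    (contDiff_const.mul ((S.contDiff.comp h).inner ℝ h))

theorem hessianMatrix_quadratic (b y : EuclideanSpace ℝ (Fin d))
    {S : EuclideanSpace ℝ (Fin d) →L[ℝ] EuclideanSpace ℝ (Fin d)}
    (hS : ∀ h k, inner ℝ (S h) k = inner ℝ h (S k)) (x : EuclideanSpace ℝ (Fin d)) :
    hessianMatrix (fun z => inner ℝ b (z - y) + 1 / 2 * inner ℝ (S (z - y)) (z - y)) x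
      = operatorMatrix S := by
  have hid : ∀ z, HasFDerivAt (fun z : EuclideanSpace ℝ (Fin d) => z - y)
      (ContinuousLinearMap.id ℝ _) z := fun z => (hasFDerivAt_id z).sub_const y
  have hSd : ∀ z, HasFDerivAt (fun z => S (z - y)) S z := fun z => by
    have h := S.hasFDerivAt.comp z (hid z)
    rw [ContinuousLinearMap.comp_id] at h
    exact h
  have h1 : ∀ z v, fderiv ℝ (fun z => inner ℝ b (z - y) + 1 / 2 * inner ℝ (S (z - y)) (z - y)) z v
      = inner ℝ b v + inner ℝ (S (z - y)) v := by
    intro z v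
    have h := (((hasFDerivAt_const b z).inner ℝ (hid z)).add
      (((hSd z).inner ℝ (hid z)).const_mul (1 / 2)))
    have h' : fderiv ℝ (fun z => inner ℝ b (z - y) + 1 / 2 * inner ℝ (S (z - y)) (z - y)) z = _ :=
      h.fderiv
    rw [h']
    simp only [add_apply, smul_apply, ContinuousLinearMap.comp_apply,
      ContinuousLinearMap.prod_apply, fderivInnerCLM_apply, ContinuousLinearMap.id_apply,
      smul_eq_mul, zero_apply, inner_zero_left]
    rw [hS v (z - y), real_inner_comm (S (z - y)) v]
    ring
  ext i j
  simp only [hessianMatrix, Matrix.of_apply, h1, operatorMatrix_apply]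
  have h2 := ((hSd x).inner ℝ (hasFDerivAt_const (EuclideanSpace.single i (1 : ℝ)) x)).const_add
    (inner ℝ b (EuclideanSpace.single i (1 : ℝ)))
  have h3 : fderiv ℝ (fun z => inner ℝ b (EuclideanSpace.single i (1 : ℝ)) +
    inner ℝ (S (z - y)) (EuclideanSpace.single i (1 : ℝ))) x = _ := h2.fderiv
  rw [h3]
  simp only [ContinuousLinearMap.comp_apply, ContinuousLinearMap.prod_apply, fderivInnerCLM_apply,
    zero_apply, inner_zero_right, zero_add]
  rw [real_inner_comm]

/-- A smooth function has a smooth gradient field, whose derivative is given by the Hessian. -/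
theorem exists_gradient_of_contDiff {ψ : EuclideanSpace ℝ (Fin d) → ℝ} (hψ : ContDiff ℝ ∞ ψ) :
    ∃ G : EuclideanSpace ℝ (Fin d) → EuclideanSpace ℝ (Fin d),
      ContDiff ℝ ∞ G ∧ (∀ x, HasFDerivAt ψ (innerSL ℝ (G x)) x) ∧
      ∀ x, ∃ T, HasFDerivAt G T x ∧ operatorMatrix T = hessianMatrix ψ x := by
  set J := (InnerProductSpace.toDual ℝ (EuclideanSpace ℝ (Fin d))).symm with hJ
  have hG : ContDiff ℝ ∞ fun x => J (fderiv ℝ ψ x) :=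
    J.contDiff.comp (hψ.fderiv_right (m := ∞) (by simp))
  have hGi : ∀ x v, inner ℝ (J (fderiv ℝ ψ x)) v = fderiv ℝ ψ x v := fun x v => by
    rw [hJ, InnerProductSpace.toDual_symm_apply]
  refine ⟨fun x => J (fderiv ℝ ψ x), hG, fun x => ?_, fun x => ?_⟩
  · refine (hψ.differentiable (by simp) x).hasFDerivAt.congr_fderiv ?_
    ext v
    rw [innerSL_apply_apply, hGi]
  · have hd := (hG.differentiable (by simp) x).hasFDerivAt
    refine ⟨_, hd, ?_⟩
    ext i j
    rw [operatorMatrix_apply]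
    have h := hd.inner ℝ (hasFDerivAt_const (EuclideanSpace.single i (1 : ℝ)) x)
    simp only [hGi] at h
    simp only [hessianMatrix, Matrix.of_apply]
    rw [h.fderiv]
    simp only [ContinuousLinearMap.comp_apply, ContinuousLinearMap.prod_apply,
      fderivInnerCLM_apply, zero_apply, inner_zero_right, zero_add]
    rw [real_inner_comm]

end MatrixOperator

/-! ### Removal of the degeneracy, and comparison. -/

section Viscosity

variable {d : ℕ} {Ω : Set (EuclideanSpace ℝ (Fin d))} {p : ℝ≥0∞} {lam Lam : ℝ}
  {F : Matrix (Fin d) (Fin d) ℝ → ℝ} {wt u v : EuclideanSpace ℝ (Fin d) → ℝ}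

/-- Through this duality, results on subsolutions apply to `-v`, since `M ↦ -F(-M)` has the same
ellipticity constants. -/
theorem IsLpViscositySupersolution.neg
    (hv : IsLpViscositySupersolution p Ω (fun M x => wt x * F M) (fun _ => 0) v) :
    IsLpViscositySubsolution p Ω (fun M x => wt x * -F (-M)) (fun _ => 0) (fun x => -v x) := by
  refine ⟨hv.1.neg, fun φ H hφc hφ x₀ hx₀ hmax => ?_⟩
  have hmin : IsLocalMin (fun x => v x - -1 * φ x) x₀ := by
    filter_upwards [hmax] with x hx
    linarith
  have h := hv.2 (fun x => -1 * φ x) (fun x => (-1 : ℝ) • H x) (hφc.const_mul (-1))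
    (hφ.const_mul (-1)) x₀ hx₀ hmin
  rw [essLiminfAt] at h
  rw [essLimsupAt, ← EReal.neg_le_neg_iff, neg_zero]
  refine le_trans (le_of_eq ?_) h
  rw [← EReal.liminf_neg]
  congr 1
  ext x
  rw [Pi.neg_apply, ← EReal.coe_neg]
  congr 1
  simp

/-- Tests with a quadratic polynomial from the `L^p` theory: a test function with very negative
Pucci operator is used as a perturbation that absorbs the degeneracy of the weight. -/
theorem IsLpViscositySubsolution.isQuadraticSubsolutionAt (hwt : ∀ x, 0 ≤ wt x) (hlam : 0 < lam)
    (hLam : lam ≤ Lam) (hF : IsElliptic lam Lam F) (hΩ : IsOpen Ω)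
    (hu : IsLpViscositySubsolution p Ω (fun M x => wt x * F M) (fun _ => 0) u)
    {φ : EuclideanSpace ℝ (Fin d) → ℝ}
    {H : EuclideanSpace ℝ (Fin d) → Matrix (Fin d) (Fin d) ℝ}
    (hφc : ContinuousOn φ Ω) (hφ : MemW2pLocWithHessian p Ω φ H)
    {x₀ : EuclideanSpace ℝ (Fin d)} {R c : ℝ} (hc : 0 < c) (hR : Metric.ball x₀ R ⊆ Ω)
    (hH : ∀ᵐ x, x ∈ Metric.ball x₀ R → wt x * pucciMax lam Lam (H x) ≤ -c)
    {y : EuclideanSpace ℝ (Fin d)} (hy : y ∈ Metric.ball x₀ R) :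
    IsQuadraticSubsolutionAt (fun T => F (operatorMatrix T)) u y := by
  intro b S hS hmax
  by_contra! hneg
  have hLam0 : 0 < Lam := hlam.trans_le hLam
  -- Raising the Hessian by `η` makes the contact strict and uses up exactly the available slack:
  -- `F(S) + Lam η = 0`.
  set η := -F (operatorMatrix S) / Lam with hη
  have hη0 : 0 < η := div_pos (neg_pos.2 hneg) hLam0
  set S' := S + η • ContinuousLinearMap.id ℝ (EuclideanSpace ℝ (Fin d)) with hS'
  have hS's : ∀ h k, inner ℝ (S' h) k = inner ℝ h (S' k) := by
    intro h k
    simp [hS', inner_add_left, inner_add_right, hS h k, inner_smul_left, inner_smul_right]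
  have hFS' : F (operatorMatrix S') ≤ 0 := by
    have h : F (operatorMatrix S') ≤ F (operatorMatrix S) + Lam * η :=
      hF.isEllipticOperator.add_smul_id_le hLam0.le hS hη0.le
    have : Lam * η = -F (operatorMatrix S) := by rw [hη]; field_simp
    linarith
  set Q : EuclideanSpace ℝ (Fin d) → ℝ :=
    fun z => inner ℝ b (z - y) + 1 / 2 * inner ℝ (S' (z - y)) (z - y) with hQ
  have hQs : ContDiff ℝ ∞ Q := contDiff_quadratic b y S'
  have hQy : Q y = 0 := by simp [hQ]
  obtain ⟨ρ, hρ0, hρ⟩ := Metric.eventually_nhds_iff_ball.1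
    (hmax.and (Metric.isOpen_ball.mem_nhds hy))
  set r := ρ / 2 with hr
  have hr0 : 0 < r := by positivity
  have hcl : ∀ z ∈ Metric.closedBall y r, z ∈ Metric.ball y ρ := fun z hz =>
    Metric.closedBall_subset_ball (by linarith) hz
  have hstrict : ∀ z ∈ Metric.closedBall y r, u z - Q z ≤ u y - η / 2 * ‖z - y‖ ^ 2 := by
    intro z hz
    have h := (hρ z (hcl z hz)).1
    simp only [hQ, hS', sub_self, inner_zero_right, add_apply, inner_add_left, smul_apply,
      ContinuousLinearMap.id_apply, map_zero, inner_smul_left, conj_trivial,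
      real_inner_self_eq_norm_sq] at h ⊢
    linarith
  have hclΩ : Metric.closedBall y r ⊆ Ω := fun z hz => hR (hρ z (hcl z hz)).2
  obtain ⟨K, hK⟩ := (isCompact_closedBall y r).exists_bound_of_continuousOn (hφc.mono hclΩ)
  have hK0 : 0 ≤ K := (norm_nonneg _).trans (hK y (Metric.mem_closedBall_self hr0.le))
  -- With this `t`, the oscillation of `tφ`, at most `2tK`, stays below the gap `ηr²/2` on the
  -- sphere, so the perturbed maximum is interior.
  set t := η * r ^ 2 / (8 * (K + 1)) with ht
  have ht0 : 0 < t := by positivity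
  have htK : t * K < η * r ^ 2 / 4 := by
    rw [ht, div_mul_eq_mul_div, div_lt_div_iff₀ (by positivity) (by norm_num)]
    have : 0 < η * r ^ 2 := by positivity
    nlinarith
  obtain ⟨z, hz, hzmax⟩ := (isCompact_closedBall y r).exists_isMaxOn
    ⟨y, Metric.mem_closedBall_self hr0.le⟩ (f := fun z => u z - (Q z + t * φ z))
    (((hu.1.mono hclΩ).sub (hQs.continuous.continuousOn.add
      ((hφc.mono hclΩ).const_mul t))))
  have hzb : z ∈ Metric.ball y r := by
    rw [Metric.mem_ball]
    refine lt_of_le_of_ne hz fun hs => ?_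
    have h1 : u y - (Q y + t * φ y) ≤ u z - (Q z + t * φ z) :=
      hzmax (Metric.mem_closedBall_self hr0.le)
    have h2 := hstrict z hz
    rw [dist_eq_norm] at hs
    rw [hs] at h2
    have h3 := mul_le_mul_of_nonneg_left (abs_le.1 (hK y (Metric.mem_closedBall_self hr0.le))).2
      ht0.le
    have h4 := mul_le_mul_of_nonneg_left (abs_le.1 (hK z hz)).1 ht0.le
    rw [hQy] at h1
    have : 0 < η * r ^ 2 := by positivity
    linarith
  have hloc : IsLocalMax (fun z => u z - (Q z + t * φ z)) z :=
    (hzmax.on_subset Metric.ball_subset_closedBall).isLocalMax (Metric.isOpen_ball.mem_nhds hzb)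
  have hW := (hQs.memW2pLocWithHessian (p := p) (Ω := Ω)).add (hφ.const_mul t)
  have hess := hu.2 _ _ (hQs.continuous.continuousOn.add (hφc.const_mul t)) hW z (hclΩ hz) hloc
  have hbound : essLimsupAt (fun x => wt x * F (hessianMatrix Q x + t • H x) - 0) z
      ≤ ((-(t * c) : ℝ) : EReal) := by
    refine limsup_le_of_le (by isBoundedDefault) ?_
    have hnhds : ∀ᶠ x in 𝓝 z, x ∈ Metric.ball x₀ R :=
      Metric.isOpen_ball.mem_nhds (hρ z (hcl z hz)).2
    filter_upwards [hnhds.filter_mono inf_le_left, hH.filter_mono inf_le_right,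
      (hφ.ae_isSymm hΩ).filter_mono inf_le_right] with x hx hxH hxs
    have hxs := hxs (hR hx)
    have hxH := hxH hx
    rw [EReal.coe_le_coe_iff, sub_zero, hessianMatrix_quadratic b y hS's]
    -- As `F(S') ≤ 0`, ellipticity leaves `F(S' + tH) ≤ t 𝓜⁺(H)`. Its product with the weight is at
    -- most `-tc`, a bound that does not degenerate where the weight vanishes.
    obtain ⟨A, hA, hFA⟩ := hF.exists_admissible hLam (isSymm_operatorMatrix hS's)
      (hxs.smul t)
    rw [Matrix.mul_smul, Matrix.trace_smul, smul_eq_mul] at hFA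
    have h1 := mul_le_mul_of_nonneg_left (hA.trace_mul_le_pucciMax hlam.le (H x)) ht0.le
    have h2 : F (operatorMatrix S' + t • H x) ≤ t * pucciMax lam Lam (H x) := by linarith
    calc wt x * F (operatorMatrix S' + t • H x) ≤ wt x * (t * pucciMax lam Lam (H x)) :=
          mul_le_mul_of_nonneg_left h2 (hwt x)
      _ = t * (wt x * pucciMax lam Lam (H x)) := by ring
      _ ≤ t * -c := mul_le_mul_of_nonneg_left hxH ht0.le
      _ = _ := by ring
  have h0 : (0 : EReal) ≤ ((-(t * c) : ℝ) : EReal) := hess.trans hbound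
  rw [← EReal.coe_zero, EReal.coe_le_coe_iff] at h0
  have : 0 < t * c := by positivity
  linarith

/-- Comparison of a sub- and a supersolution with a strict supersolution of the Pucci equation. -/
theorem no_touching_of_isQuadraticSubsolutionAt (hlam : 0 < lam) (hLam : lam ≤ Lam)
    (hF : IsElliptic lam Lam F) {x₀ : EuclideanSpace ℝ (Fin d)} {R c : ℝ} (hR0 : 0 < R)
    (hc : 0 < c) (hR : Metric.closedBall x₀ R ⊆ Ω)
    (hu : ContinuousOn u Ω) (hv : ContinuousOn v Ω)
    (hus : ∀ y ∈ Metric.ball x₀ R,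
      IsQuadraticSubsolutionAt (fun T => F (operatorMatrix T)) u y)
    (hvs : ∀ y ∈ Metric.ball x₀ R,
      IsQuadraticSubsolutionAt (fun T => -F (-operatorMatrix T)) (fun x => -v x) y)
    {φ : EuclideanSpace ℝ (Fin d) → ℝ}
    {H : EuclideanSpace ℝ (Fin d) → Matrix (Fin d) (Fin d) ℝ}
    (hφc : ContinuousOn φ Ω) (hφ : MemW2pLocWithHessian p Ω φ H)
    (hH : ∀ᵐ x, x ∈ Metric.ball x₀ R → ∀ A ∈ {A | PucciAdmissible lam Lam A},
      (A * H x).trace ≤ -c)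
    (hmax : ∀ y ∈ Metric.ball x₀ R, u y - v y - φ y ≤ u x₀ - v x₀ - φ x₀) : False := by
  have hLam0 : 0 < Lam := hlam.trans_le hLam
  set r := R / 4 with hr
  have hr0 : 0 < r := by positivity
  -- Chosen so that `η tr A ≤ η d Lam ≤ c/2` for admissible `A`.
  set η := c / (2 * (d * Lam + 1)) with hη
  have hη0 : 0 < η := by positivity
  -- The quadratic term gains `8τ` on the sphere. The errors are `τ` for each of `U` and `W` and
  -- `2τ` for `ψ`, leaving a margin of `4τ`.
  set τ := η / 2 * r ^ 2 / 8 with hτ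
  have hτ0 : 0 < τ := by positivity
  have hsub2 : Metric.closedBall x₀ (R / 2) ⊆ Ω :=
    (Metric.closedBall_subset_closedBall (by linarith)).trans hR
  have hball2 : Metric.ball x₀ (R / 2) ⊆ Metric.ball x₀ R := Metric.ball_subset_ball (by linarith)
  have hrR : r < R / 2 := by rw [hr]; linarith
  obtain ⟨U, GU, hU, ⟨CU, hCU⟩, hUu, hUF⟩ := exists_regularization_of_subsolution hlam hLam
    hF.isEllipticOperator hr0 hrR (hu.mono hsub2) (fun y hy => hus y (hball2 hy)) hτ0
  obtain ⟨W, GW, hW, ⟨CW, hCW⟩, hWv, hWF⟩ := exists_regularization_of_subsolution hlam hLam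
    hF.neg_comp_neg.isEllipticOperator hr0 hrR (hv.neg.mono hsub2)
    (fun y hy => hvs y (hball2 hy)) hτ0
  obtain ⟨ψ, hψ, hψφ, hψH⟩ := hφ.exists_contDiff_approx hφc (r := r) (by linarith) hR hH hτ0
  obtain ⟨Gψ, hGψ, hψd, hψT⟩ := exists_gradient_of_contDiff hψ
  obtain ⟨CG, hCG⟩ := (hGψ.contDiffOn (s := Metric.closedBall x₀ r)).exists_lipschitzOnWith
    (by simp) (convex_closedBall x₀ r) (isCompact_closedBall x₀ r)
  set w : EuclideanSpace ℝ (Fin d) → ℝ := fun x => U x + W x - ψ x - η / 2 * ‖x - x₀‖ ^ 2 with hw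
  set G : EuclideanSpace ℝ (Fin d) → EuclideanSpace ℝ (Fin d) :=
    fun x => GU x + GW x - Gψ x - η • (x - x₀) with hG
  have hwd : ∀ x, HasFDerivAt w (innerSL ℝ (G x)) x := by
    intro x
    have h1 : HasFDerivAt (fun x => ‖x - x₀‖ ^ 2) (2 • innerSL ℝ (x - x₀)) x := by
      have h := ((hasFDerivAt_id x).sub_const x₀).norm_sq
      rw [ContinuousLinearMap.comp_id] at h
      exact h
    refine ((((hU x).add (hW x)).sub (hψd x)).sub (h1.const_mul (η / 2))).congr_fderiv ?_
    ext k
    simp only [hG, sub_apply, add_apply, smul_apply, innerSL_apply_apply, inner_sub_left,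
      inner_add_left, inner_smul_left, conj_trivial, smul_eq_mul, nsmul_eq_mul]
    push_cast
    ring
  have hGlip : ∃ C, LipschitzOnWith C G (Metric.closedBall x₀ r) :=
    ⟨_, (((hCU.lipschitzOnWith).add hCW.lipschitzOnWith).sub hCG).sub
      ((lipschitzWith_smul η).comp
        (LipschitzWith.id.sub (LipschitzWith.const x₀))).lipschitzOnWith⟩
  obtain ⟨C, hC⟩ := hGlip
  have hx₀r : x₀ ∈ Metric.closedBall x₀ r := Metric.mem_closedBall_self hr0.le
  have hbd : ∀ y ∈ Metric.sphere x₀ r, w y + η / 2 * r ^ 2 / 2 ≤ w x₀ := by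
    intro y hy
    have hy' := Metric.sphere_subset_closedBall hy
    rw [mem_sphere_iff_norm] at hy
    have h1 := hmax y (Metric.closedBall_subset_ball (by linarith) hy')
    have h2 := (hUu y hy').2
    have h3 := (hWv y hy').2
    have h4 := (abs_le.1 (hψφ y hy')).1
    have h5 := (hUu x₀ hx₀r).1
    have h6 := (hWv x₀ hx₀r).1
    have h7 := (abs_le.1 (hψφ x₀ hx₀r)).2
    rw [Pi.neg_apply] at h3 h6
    simp only [hw, hy, sub_self, norm_zero]
    have : η / 2 * r ^ 2 = 8 * τ := by rw [hτ]; ring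
    rw [this]
    linarith
  have hnull : volume {x | ¬ (DifferentiableAt ℝ GU x ∧ DifferentiableAt ℝ GW x)} = 0 := by
    have h1 := hCU.ae_differentiableAt (μ := volume)
    have h2 := hCW.ae_differentiableAt (μ := volume)
    exact ae_iff.1 (h1.and h2)
  obtain ⟨x, hx, hxN, q, hxq⟩ := exists_isLocalMax_sub_inner volume hr0
    (show 0 < η / 2 * r ^ 2 / 2 by positivity) hwd hC hbd hnull
  simp only [mem_ofPred_eq, not_not] at hxN
  obtain ⟨⟨TU, hTU⟩, ⟨TW, hTW⟩⟩ := hxN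
  obtain ⟨Tψ, hTψ, hTψM⟩ := hψT x
  have hx' := Metric.ball_subset_closedBall hx
  have hGd : HasFDerivAt G (TU + TW - Tψ - η • ContinuousLinearMap.id ℝ _) x :=
    ((hTU.add hTW).sub hTψ).sub (((hasFDerivAt_id x).sub_const x₀).const_smul η)
  have hneg := inner_apply_nonpos_of_isLocalMax hwd hGd hxq
  have hsymm := inner_symm_of_hasFDerivAt_grad hwd hGd
  have hPSD := posSemidef_operatorMatrix
    (T := -(TU + TW - Tψ - η • ContinuousLinearMap.id ℝ _))
    (fun h k => by rw [neg_apply, neg_apply, inner_neg_left, inner_neg_right, hsymm])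
    (fun h => by rw [neg_apply, inner_neg_left]; linarith [hneg h])
  have hUs := isSymm_operatorMatrix (inner_symm_of_hasFDerivAt_grad hU hTU)
  have hWs := isSymm_operatorMatrix (inner_symm_of_hasFDerivAt_grad hW hTW)
  have hψs := isSymm_operatorMatrix (inner_symm_of_hasFDerivAt_grad hψd hTψ)
  have hFU : 0 ≤ F (operatorMatrix TU) := hUF x hx' TU hTU
  have hFW : 0 ≤ -F (-operatorMatrix TW) := hWF x hx' TW hTW
  have hψtr := hψH x hx'
  rw [← hTψM, hψs.eq] at hψtr
  have hone : operatorMatrix (ContinuousLinearMap.id ℝ (EuclideanSpace ℝ (Fin d))) = 1 :=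
    map_one _
  have e : operatorMatrix (-(TU + TW - Tψ - η • ContinuousLinearMap.id ℝ _))
      = (-operatorMatrix TW + (operatorMatrix Tψ + η • (1 : Matrix (Fin d) (Fin d) ℝ)))
        - operatorMatrix TU := by
    rw [← hone]
    simp only [operatorMatrix, map_neg, map_sub, map_add, map_smul]
    abel
  rw [e] at hPSD
  -- The Hessian inequality at the maximum places `D²U` below `-D²W + D²ψ + ηI`; with `A` from
  -- ellipticity, `0 ≤ -c + c/2` results.
  have h1 := hF.mono hlam.le hUs hPSD
  obtain ⟨A, hA, hFA⟩ := hF.exists_admissible hLam hWs.neg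
    (hψs.add (Matrix.isSymm_one.smul η))
  have h2 := hψtr A hA
  rw [mul_add, Matrix.trace_add, Matrix.mul_smul, Matrix.trace_smul, mul_one, smul_eq_mul] at hFA
  have h3 := mul_le_mul_of_nonneg_left hA.trace_le hη0.le
  have h4 : η * (d * Lam) ≤ c / 2 := by
    rw [hη, div_mul_eq_mul_div, div_le_div_iff₀ (by positivity) (by norm_num)]
    nlinarith
  linarith

end Viscosity

/-! ### The main theorem. -/

theorem theorem3p3 (n : ℕ) (p : ℝ≥0∞) (hp1 : 1 ≤ p) (hp : ((n + 1 : ℕ) : ℝ≥0∞) < 2 * p)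
    (a lam Lam : ℝ) (ha : 0 < a) (hlam : 0 < lam) (hLam : lam ≤ Lam)
    (F : Matrix (Fin (n + 1)) (Fin (n + 1)) ℝ → ℝ) (hF : IsElliptic lam Lam F)
    (u v : EuclideanSpace ℝ (Fin (n + 1)) → ℝ)
    (hu : IsLpViscositySubsolution p (Metric.ball 0 1)
      (fun M x => lastCoordWeight a x * F M) (fun _ => 0) u)
    (hv : IsLpViscositySupersolution p (Metric.ball 0 1)
      (fun M x => lastCoordWeight a x * F M) (fun _ => 0) v) :
    MemPucciLower p (Metric.ball 0 1) a lam Lam (fun _ => 0) (fun x => u x - v x) := by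
  refine ⟨hu.1.sub hv.1, fun φ H hφc hφ x₀ hx₀ hmax => ?_⟩
  by_contra! hneg
  obtain ⟨c', hc1, hc2⟩ := EReal.lt_iff_exists_real_btwn.1 hneg
  have hc0 : 0 < -c' := by
    have : c' < 0 := by exact_mod_cast hc2
    linarith
  have hev := eventually_lt_of_limsup_lt hc1
  -- The strict bound on the essential limsup holds on a neighbourhood `s` of `x₀` intersected with
  -- a set `t` of full measure.
  obtain ⟨s, hs, t, ht, hst⟩ := mem_inf_iff_superset.1 hev
  obtain ⟨R', hR', hball⟩ := Metric.mem_nhds_iff.1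
    (inter_mem (inter_mem hs (Metric.isOpen_ball.mem_nhds hx₀)) hmax)
  have hwt : ∀ x : EuclideanSpace ℝ (Fin (n + 1)), 0 ≤ lastCoordWeight a x :=
    fun x => Real.rpow_nonneg (abs_nonneg _) _
  have hwt1 : ∀ x ∈ Metric.ball (0 : EuclideanSpace ℝ (Fin (n + 1))) 1,
      lastCoordWeight a x ≤ 1 := by
    intro x hx
    refine Real.rpow_le_one (abs_nonneg _) ?_ ha.le
    rw [mem_ball_zero_iff] at hx
    exact (PiLp.norm_apply_le x (Fin.last n)).trans hx.le
  set R := R' / 2 with hR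
  have hR0 : 0 < R := by positivity
  have hcl : Metric.closedBall x₀ R ⊆ Metric.ball x₀ R' := Metric.closedBall_subset_ball (by linarith)
  have hΩ : Metric.closedBall x₀ R ⊆ Metric.ball 0 1 := fun x hx => (hball (hcl hx)).1.2
  have hpucci : ∀ᵐ x, x ∈ Metric.ball x₀ R →
      lastCoordWeight a x * pucciMax lam Lam (H x) ≤ -(-c') := by
    filter_upwards [ht] with x hxt hx
    have h := hst ⟨(hball (hcl (Metric.ball_subset_closedBall hx))).1.1, hxt⟩
    have h' : lastCoordWeight a x * pucciMax lam Lam (H x) - 0 < c' := by exact_mod_cast h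
    linarith
  have hus := fun y (hy : y ∈ Metric.ball x₀ R) =>
    IsLpViscositySubsolution.isQuadraticSubsolutionAt hwt hlam hLam hF Metric.isOpen_ball hu
      hφc hφ hc0 (Metric.ball_subset_closedBall.trans hΩ) hpucci hy
  have hvs := fun y (hy : y ∈ Metric.ball x₀ R) =>
    IsLpViscositySubsolution.isQuadraticSubsolutionAt hwt hlam hLam hF.neg_comp_neg
      Metric.isOpen_ball hv.neg hφc hφ hc0 (Metric.ball_subset_closedBall.trans hΩ) hpucci hy
  refine no_touching_of_isQuadraticSubsolutionAt hlam hLam hF hR0 hc0 hΩ hu.1 hv.1 hus hvs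
    hφc hφ ?_ fun y hy => (hball (hcl (Metric.ball_subset_closedBall hy))).2
  filter_upwards [hpucci] with x hx hxR A hA
  have h1 := hx hxR
  have hxΩ := hΩ (Metric.ball_subset_closedBall hxR)
  -- A negative product with a nonnegative weight forces `𝓜⁺ < 0`; as the weight is at most `1`,
  -- removing it only lowers the value.
  have h2 : pucciMax lam Lam (H x) ≤ -(-c') := by
    have hneg : pucciMax lam Lam (H x) < 0 := by
      by_contra! h
      have := mul_nonneg (hwt x) h
      linarith
    have h3 := mul_nonneg (sub_nonneg.2 (hwt1 x hxΩ)) (neg_nonneg.2 hneg.le)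
    linarith
  exact (PucciAdmissible.trace_mul_le_pucciMax hlam.le hA (H x)).trans h2
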